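/- Let $V=\mathbb R^n$ and let $J^k(V)$ be the space of $k$-jets of smooth functions on $V$, with coordinates $x^i$, $u$, $u_{i_1\cdots i_j}$ ($1\le j\le k$). The group $\mathrm{Aff}(V)$ of affine automorphisms acts on $V\times\mathbb R$ by $(x,u)\mapsto(gx,u)$ and, by prolongation, on $J^k(V)$: the $k$-jet of $f$ at $x$ goes to the $k$-jet of $f\circ g^{-1}$ at $gx$. For $l\ge 2$, a *scalar differential invariant* of order $k$ is a function $\varphi=P/Q$ on $J^k(V)$ that is constant on $\mathrm{Aff}(V)$-orbits where it is defined. Here $P,Q$ are polynomials in the fibre coordinates $u_{i_1\cdots i_j}$, $1\le j\le k$, with coefficients in $C^\infty(V\times\mathbb R)$, $Q$ contains only fibre coordinates of order $\le l$, and $Q$ does not vanish identically on any fibre of $J^k(V)\to V\times\mathbb R$. Thus $\varphi$ is smooth in $(x,u)$, rational in the fibre coordinates of order $\le l$ and polynomial in the higher ones. For a smooth function $f$ on $V$, let $L=\{\lambda_i=\partial f/\partial x^i\}\subset V\times V^*$ be the corresponding Lagrangian submanifold, considered at points where the Hessian $(\partial^2 f/\partial x^i\partial x^j)$ is invertible;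 $L$ is parametrized by $x$, and $\lambda$ gives local coordinates on it. Put $H=f-\langle\lambda,x\rangle$ and $Z=e^{-H}$. The $k$th moment is $$m_k=\frac{Z_{\lambda_{i_1}\cdots\lambda_{i_k}}}{Z}\,d\lambda_{i_1}\otimes\cdots\otimes d\lambda_{i_k},$$ and the $k$th central moment $\sigma_k$ is the $k$th moment about the mean $m_1=x$. That is, at a point of $L$ with mean $c=m_1$, it is obtained from the same formula with $Z$ replaced by $e^{-\langle\lambda,c\rangle}Z(\lambda)$ ($c$ held fixed while differentiating). Let $\alpha_1=\lambda_i\,dx^i$. Define vectors on $L$ by $v_1=\sigma_2^{-1}(\alpha_1)$ and $v_i=A^{i-1}v_1$ for $1\le i\le n$, where the endomorphism $A$ of $TL$ is given by $\sigma_2(Aw,w')=\sigma_3(v_1,w,w')$. Call a jet *regular* if the Hessian is invertible and $v_1,\dots,v_n$ are linearly independent. **Theorem.** The algebra of scalar differential invariants is generated, over the smooth functions of the zero-order invariant $u$ and in the sense of rational expressions, by the functions $\sigma_k(v_{i_1},\dots,v_{i_k})$ with $i_1\le\cdots\le i_k$ and $k=2,3,\dots$. Precisely: 1. The regular $3$-jets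 form the complement in $J^3(V)$ of the zero set of a real polynomial in the fibre coordinates that does not vanish identically on any fibre of $J^3(V)\to V\times\mathbb R$. 2. Every $\sigma_k(v_{i_1},\dots,v_{i_k})$ with $k\ge2$ and $i_1\le\cdots\le i_k$ is a scalar differential invariant of order $\max(3,k)$, rational in the fibre coordinates of order $\le 2$ and polynomial in those of order $\ge 3$, and is defined wherever the Hessian is invertible. 3. Let $l\ge2$, and let $\varphi$ be a scalar differential invariant of any order that is smooth in $(x,u)$, rational in the fibre coordinates of order $\le l$ and polynomial in the higher ones. Then there are polynomials $N,D$ in the functions $\sigma_k(v_{i_1},\dots,v_{i_k})$, $k\ge 2$, $i_1\le\cdots\le i_k$, with coefficients smooth functions of $u\in\mathbb R$, such that $D$ involves only those with $k\le l$, $D$ is not identically zero on the regular jets over any point $(x,u)\in V\times\mathbb R$, and $\varphi=N/D$ at all regular jets at which $\varphi$ is defined and $D\ne0$. -/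

import Mathlib

open scoped ContDiff

noncomputable section

namespace Measurement

/-- The space `V = ℝⁿ` in which points are measured. -/
abbrev Space (n : ℕ) : Type := Fin n → ℝ

/-- The group `Aff(V)` of affine automorphisms of `V`. -/
abbrev Aff (n : ℕ) : Type := Space n ≃ᵃ[ℝ] Space n

/-- Standard basis vectors of `V`. -/
def e {n : ℕ} (i : Fin n) : Space n := Pi.single i 1

/-! ### Jets of functions on `V` -/

/-- Labels of the fibre coordinates `u_{i₁ ⋯ i_j}`, `1 ≤ j ≤ k`, of `J^k(V) → J^0(V) = V × ℝ`.
The label `⟨j, τ⟩` stands for a coordinate of order `j + 1`. All tuples of indices are allowed,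
so that coordinates differing by a permutation of the indices coincide on jets. -/
abbrev FiberIndex (n k : ℕ) : Type := Σ j : Fin k, (Fin (j.1 + 1) → Fin n)

/-- Coordinate values: the base point `x`, the value `u` and the fibre coordinates. -/
structure JetCoord (n k : ℕ) where
  base : Space n
  value : ℝ
  fiber : FiberIndex n k → ℝ

/-- The `k`-jet of `f` at `x`: its coordinates are `x`, `f x` and the partial derivatives of `f`
at `x` up to order `k`. -/
def jet {n : ℕ} (k : ℕ) (f : Space n → ℝ) (x : Space n) : JetCoord n k where
  base := x
  value := f x
  fiber := fun τ => iteratedFDeriv ℝ (τ.1.1 + 1) f x (fun r => e (τ.2 r))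

/-- The space `J^k(V)` of `k`-jets of smooth functions on `V`. -/
def JetSpace (n k : ℕ) : Set (JetCoord n k) :=
  {z | ∃ (f : Space n → ℝ) (x : Space n), ContDiff ℝ ∞ f ∧ z = jet k f x}

/-- `z` and `z'` lie in one orbit of the prolonged action of `Aff(V)` on `J^k(V)`. The affine map
`g` acts on `V × ℝ` by `(x, u) ↦ (g x, u)`, hence on functions by `f ↦ f ∘ g⁻¹`, and its
prolongation sends the `k`-jet of `f` at `x` to the `k`-jet of `f ∘ g⁻¹` at `g x`. -/
def SameOrbit {n k : ℕ} (z z' : JetCoord n k) : Prop :=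
  ∃ (f : Space n → ℝ) (x : Space n) (g : Aff n), ContDiff ℝ ∞ f ∧
    z = jet k f x ∧ z' = jet k (f ∘ g.symm) (g x)

/-! ### Rational functions on jets and scalar differential invariants -/

/-- The value at `z` of a polynomial in the fibre coordinates whose coefficients are functions
on `J^0(V) = V × ℝ`. -/
def evalJet {n k : ℕ} (P : MvPolynomial (FiberIndex n k) (Space n × ℝ → ℝ))
    (z : JetCoord n k) : ℝ :=
  MvPolynomial.eval₂ (Pi.evalRingHom (fun _ : Space n × ℝ => ℝ) (z.base, z.value)) z.fiber P

/-- Functions on `J^k(V)` that are smooth in the base variables `(x, u)`, rational in the fibre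
variables of `J^l(V) → J^0(V)` and polynomial in the fibre variables of `J^k(V) → J^l(V)`,
given as a quotient whose denominator has order at most `l` and does not vanish
identically on any fibre of `J^k(V) → J^0(V)`. -/
structure RationalJetFunction (n l k : ℕ) where
  num : MvPolynomial (FiberIndex n k) (Space n × ℝ → ℝ)
  den : MvPolynomial (FiberIndex n k) (Space n × ℝ → ℝ)
  num_smooth : ∀ m, ContDiff ℝ ∞ (num.coeff m)
  den_smooth : ∀ m, ContDiff ℝ ∞ (den.coeff m)
  den_order : ∀ τ ∈ den.vars, τ.1.1 + 1 ≤ l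
  den_ne : ∀ (x : Space n) (u : ℝ), ∃ z ∈ JetSpace n k,
    z.base = x ∧ z.value = u ∧ evalJet den z ≠ 0

/-- The function is defined at `z`. -/
def RationalJetFunction.IsDefinedAt {n l k : ℕ} (φ : RationalJetFunction n l k)
    (z : JetCoord n k) : Prop :=
  evalJet φ.den z ≠ 0

/-- The value at `z` (meaningful where the function is defined). -/
def RationalJetFunction.val {n l k : ℕ} (φ : RationalJetFunction n l k)
    (z : JetCoord n k) : ℝ :=
  evalJet φ.num z / evalJet φ.den z

/-- A scalar differential invariant of order `k`: constant on `Aff(V)`-orbits in `J^k(V)`, where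
it is defined. -/
def RationalJetFunction.IsInvariant {n l k : ℕ} (φ : RationalJetFunction n l k) : Prop :=
  ∀ z z' : JetCoord n k, SameOrbit z z' → φ.IsDefinedAt z → φ.IsDefinedAt z' →
    φ.val z' = φ.val z

/-! ### Central moments on the Lagrangian submanifold `λ = df` -/

/-- The momenta `λ_i = ∂f/∂x^i`; also the coefficients of `α₁ = λ_i dx^i`. -/
def momentum {n : ℕ} (f : Space n → ℝ) (x : Space n) : Fin n → ℝ :=
  fun i => fderiv ℝ f x (e i)

/-- The matrix `∂λ_i/∂x^j = ∂²f/∂x^i∂x^j`. -/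
def hess {n : ℕ} (f : Space n → ℝ) (x : Space n) : Matrix (Fin n) (Fin n) ℝ :=
  Matrix.of fun i j => iteratedFDeriv ℝ 2 f x ![e i, e j]

/-- The derivative `∂F/∂λ_j = ∑ i, (∂x^i/∂λ_j) (∂F/∂x^i)` of a function on the Lagrangian
submanifold `λ = df`; the submanifold is parametrized by `x`, and the `λ_j` are local
coordinates on it where the Hessian matrix is invertible. -/
def dLambda {n : ℕ} (f : Space n → ℝ) (j : Fin n) (F : Space n → ℝ) : Space n → ℝ :=
  fun x => ∑ i, (hess f x)⁻¹ i j * fderiv ℝ F x (e i)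

/-- The partition function of the random vector `X - c`, that is `exp (-⟨λ, c⟩) * Z(λ)`, where
`Z = exp (-H)` is the partition function of `X` and `H = f - ⟨λ, x⟩`. -/
def partitionFunction {n : ℕ} (f : Space n → ℝ) (c : Space n) : Space n → ℝ :=
  fun x => Real.exp (-(∑ i, momentum f x i * c i)) *
    Real.exp (-(f x - ∑ i, momentum f x i * x i))

/-- Components `Z_{λ_{i₁} ⋯ λ_{i_k}} / Z` of the `k`th moment of `X - c`. -/
def moment {n k : ℕ} (f : Space n → ℝ) (c : Space n) (τ : Fin k → Fin n) (x : Space n) : ℝ :=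
  (List.ofFn τ).foldr (dLambda f) (partitionFunction f c) x / partitionFunction f c x

/-- The first moment `m₁` of `X`. -/
def mean {n : ℕ} (f : Space n → ℝ) (x : Space n) : Space n :=
  fun i => moment f 0 ![i] x

/-- Components (with respect to the `dλ_{i₁} ⊗ ⋯ ⊗ dλ_{i_k}`) of the central moment `σ_k`, the
`k`th moment of `X - m₁(X)`. -/
def centralMoment {n k : ℕ} (f : Space n → ℝ) (τ : Fin k → Fin n) (x : Space n) : ℝ :=
  moment f (mean f x) τ x

/-- The central moment `σ_k` as a `k`-form on the tangent space at `x`, evaluated on vectors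
`w_1, …, w_k` given by their components with respect to the `∂/∂x^i`; here `dλ_i(w)` is
the `i`th entry of `hess f x *ᵥ w`. -/
def sigma {n k : ℕ} (f : Space n → ℝ) (x : Space n) (w : Fin k → Space n) : ℝ :=
  ∑ τ : Fin k → Fin n, centralMoment f τ x * ∏ r, (hess f x).mulVec (w r) (τ r)

/-! ### The invariant frame and the generators -/

/-- The matrix of the symmetric 2-form `σ₂`. -/
def sigmaTwo {n : ℕ} (f : Space n → ℝ) (x : Space n) : Matrix (Fin n) (Fin n) ℝ :=
  Matrix.of fun i j => sigma f x ![e i, e j]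

/-- The vector `v₁ = σ₂⁻¹(α₁)`. -/
def vOne {n : ℕ} (f : Space n → ℝ) (x : Space n) : Space n :=
  (sigmaTwo f x)⁻¹.mulVec (momentum f x)

/-- The endomorphism `A`, determined by `σ₂(A w, w') = σ₃(v₁, w, w')`. -/
def endoA {n : ℕ} (f : Space n → ℝ) (x : Space n) : Matrix (Fin n) (Fin n) ℝ :=
  (sigmaTwo f x)⁻¹ * Matrix.of fun i j => sigma f x ![vOne f x, e i, e j]

/-- The frame `v_i = A^{i-1} v₁`, `1 ≤ i ≤ n` (numbered from `0` here). -/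
def frame {n : ℕ} (f : Space n → ℝ) (x : Space n) (i : Fin n) : Space n :=
  ((endoA f x) ^ i.1).mulVec (vOne f x)

/-- `σ₂` is nondegenerate and `v₁, …, v_n` is a frame at `x`. -/
def IsRegularAt {n : ℕ} (f : Space n → ℝ) (x : Space n) : Prop :=
  (hess f x).det ≠ 0 ∧ LinearIndependent ℝ (frame f x)

/-- Labels of the frame coefficients `σ_k(v_{i₁}, …, v_{i_k})`, `k ≥ 2`, `i₁ ≤ ⋯ ≤ i_k`; the label
`⟨m, τ⟩` belongs to `k = m + 2`. -/
abbrev GenIndex (n : ℕ) : Type := Σ m : ℕ, {τ : Fin (m + 2) → Fin n // Monotone τ}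

/-- The frame coefficients `σ_k(v_{i₁}, …, v_{i_k})`. -/
def generator {n : ℕ} (f : Space n → ℝ) (x : Space n) (I : GenIndex n) : ℝ :=
  sigma f x (fun r => frame f x (I.2.1 r))

/-- The value of a polynomial in the frame coefficients whose coefficients are functions of the
zero-order invariant `u`. -/
def evalGen {n : ℕ} (P : MvPolynomial (GenIndex n) (ℝ → ℝ)) (f : Space n → ℝ)
    (x : Space n) : ℝ :=
  MvPolynomial.eval₂ (Pi.evalRingHom (fun _ : ℝ => ℝ) (f x)) (generator f x) P

end Measurement

end

/-! On `L` the differential of ⟨λ, x⟩ - f is ⟨x, dλ⟩, so the partition function Z of X - c satisfies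
∂Z/∂λ_j = (x^j - c^j) Z. Hence the moments M obey M_{jτ} = ∂M_τ/∂λ_j + (x^j - c^j) M_τ
(`IsMomentExpr.cons`) and are polynomials in x - c, the derivatives of f and the inverse Hessian
determinant. The centre c stays free during differentiation; c = x is substituted afterwards.
Lowering indices with the Hessian gives σ_2 = D²f and, for k ≥ 3, σ_k = -D^k f plus terms of lower
order, with no such terms for k = 3 (`exists_sigmaCoord_add_pderiv`). This system is triangular, so
the momenta and the σ_k determine the jet polynomially once the Hessian determinant is inverted
(`pderiv_mem_sigmaAlgebra`).

Moments and frame are natural under affine maps, so the frame coefficients are invariants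
(`generator_comp_symm`). Moreover λ(v_i) = σ_2(v_1, v_i), so every derivative of f along the frame
is a polynomial in the frame coefficients divided by a power of the Gram determinant
(`exists_genPoly`).

An invariant P/Q could therefore be evaluated after moving x to 0 and the frame to the standard
basis, but Q may vanish on all jets so normalized. Instead the basis c ∑ h_{ai} v_a is used, with h
a matrix of indeterminates and c a power of the Gram determinant that absorbs all denominators. Then
P and Q become polynomials N₀ and D₀ in h over the ring of polynomials in the frame coefficients
with functions of u as coefficients. Invariance gives N₀ = φ D₀ for all invertible h with D₀(h) ≠ 0,
hence N_m = φ D_m for every coefficient (`map_liftPoly_eq`), and φ = ∑ D_m N_m / ∑ D_m². Over ℝ this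
denominator vanishes only where D₀ is zero as a polynomial in h. Some regular jet over (0, u) has Q
≠ 0 (`exists_reg_evalJet_ne_zero`); there the h which restores the standard basis shows D₀ ≠ 0, and
a translation reaches every other x. -/

namespace Measurement

/-! ### Partial derivatives -/

/-- The partial derivative `∂^k f / ∂x^{τ 0} ⋯ ∂x^{τ (k-1)}`. -/
noncomputable def pderiv {n k : ℕ} (f : Space n → ℝ) (τ : Fin k → Fin n) (x : Space n) : ℝ :=
  iteratedFDeriv ℝ k f x (fun r => e (τ r))

lemma differentiableAt_pderiv {n k : ℕ} {f : Space n → ℝ} (hf : ContDiff ℝ ∞ f)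
    (τ : Fin k → Fin n) (x : Space n) : DifferentiableAt ℝ (pderiv f τ) x := by
  have h := (hf.differentiable_iteratedFDeriv (m := k)
    (WithTop.coe_lt_coe.2 (WithTop.coe_lt_top k))) x
  unfold pderiv
  fun_prop

lemma fderiv_pderiv {n k : ℕ} {f : Space n → ℝ} (hf : ContDiff ℝ ∞ f)
    (τ : Fin k → Fin n) (x : Space n) (a : Fin n) :
    fderiv ℝ (pderiv f τ) x (e a) = pderiv f (Fin.cons a τ : Fin (k + 1) → Fin n) x := by
  have h := (hf.differentiable_iteratedFDeriv (m := k)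
    (WithTop.coe_lt_coe.2 (WithTop.coe_lt_top k))) x
  unfold pderiv
  rw [iteratedFDeriv_succ_apply_left, fderiv_continuousMultilinear_apply_const_apply h]
  simp [Fin.tail_def]

lemma contDiff_pderiv {n k : ℕ} {f : Space n → ℝ} (hf : ContDiff ℝ ∞ f)
    (τ : Fin k → Fin n) : ContDiff ℝ ∞ (pderiv f τ) := by
  have h : ContDiff ℝ ∞ (iteratedFDeriv ℝ k f) :=
    hf.iteratedFDeriv_right (m := ∞) (by exact_mod_cast le_refl _)
  exact (ContinuousMultilinearMap.apply ℝ (fun _ : Fin k => Space n) ℝ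
    (fun r => e (τ r))).contDiff.comp h

lemma pderiv_eq_foldr {n k : ℕ} {f : Space n → ℝ} (hf : ContDiff ℝ ∞ f)
    (τ : Fin k → Fin n) :
    pderiv f τ = (List.ofFn τ).foldr (fun a F y => fderiv ℝ F y (e a)) f := by
  induction k with
  | zero => ext x; simp [pderiv]
  | succ k ih =>
    rw [List.ofFn_succ, List.foldr_cons, ← ih (fun i => τ i.succ)]
    ext x
    rw [fderiv_pderiv hf]
    congr 1
    exact (Fin.cons_self_tail τ).symm

/-- Adjacent swaps generate the permutations, so symmetry of the second derivative of the inner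
function suffices. -/
lemma foldr_fderiv_perm {n : ℕ} {f : Space n → ℝ} (hf : ContDiff ℝ ∞ f)
    {L L' : List (Fin n)} (h : L.Perm L') :
    L.foldr (fun a F y => fderiv ℝ F y (e a)) f = L'.foldr (fun a F y => fderiv ℝ F y (e a)) f := by
  induction h with
  | nil => rfl
  | cons a _ ih => simp only [List.foldr_cons, ih]
  | trans _ _ ih₁ ih₂ => exact ih₁.trans ih₂
  | swap a b L =>
    simp only [List.foldr_cons]
    have hG : ContDiff ℝ ∞ (L.foldr (fun a F y => fderiv ℝ F y (e a)) f) := by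
      have := contDiff_pderiv hf L.get
      rwa [pderiv_eq_foldr hf, List.ofFn_get] at this
    set G := L.foldr (fun a F y => fderiv ℝ F y (e a)) f
    ext x
    have hd : DifferentiableAt ℝ (fderiv ℝ G) x :=
      ((hG.fderiv_right (m := ∞) (by exact_mod_cast le_refl _)).differentiable (by simp)) x
    have hs : IsSymmSndFDerivAt ℝ G x :=
      (hG.contDiffAt).isSymmSndFDerivAt (by simpa using WithTop.coe_le_coe.2 (le_top (a := (2 : ℕ∞))))
    have key : ∀ a b, fderiv ℝ (fun y => fderiv ℝ G y (e a)) x (e b)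
        = fderiv ℝ (fderiv ℝ G) x (e b) (e a) := fun a b => by
      rw [fderiv_clm_apply hd (by fun_prop)]
      simp
    rw [key, key, hs]

/-- Partial derivatives of a smooth function commute. -/
lemma pderiv_comp_perm {n k : ℕ} {f : Space n → ℝ} (hf : ContDiff ℝ ∞ f)
    (τ : Fin k → Fin n) (s : Equiv.Perm (Fin k)) (x : Space n) :
    pderiv f (τ ∘ s) x = pderiv f τ x := by
  rw [pderiv_eq_foldr hf, pderiv_eq_foldr hf, foldr_fderiv_perm hf (s.ofFn_comp_perm τ)]

lemma momentum_eq_pderiv {n : ℕ} (f : Space n → ℝ) (x : Space n) (i : Fin n) :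
    momentum f x i = pderiv f ![i] x := by
  simp [momentum, pderiv, iteratedFDeriv_one_apply]

lemma hess_eq_pderiv {n : ℕ} (f : Space n → ℝ) (x : Space n) (i j : Fin n) :
    hess f x i j = pderiv f ![i, j] x := by
  unfold hess pderiv
  rw [Matrix.of_apply]
  congr 1
  ext r
  fin_cases r <;> rfl

lemma hess_symm {n : ℕ} {f : Space n → ℝ} (hf : ContDiff ℝ ∞ f) (x : Space n) (i j : Fin n) :
    hess f x i j = hess f x j i := by
  rw [hess_eq_pderiv, hess_eq_pderiv, ← pderiv_comp_perm hf _ (Equiv.swap 0 1)]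
  congr 1
  ext r
  fin_cases r <;> rfl

lemma hess_inv_symm {n : ℕ} {f : Space n → ℝ} (hf : ContDiff ℝ ∞ f) (x : Space n) (i j : Fin n) :
    (hess f x)⁻¹ i j = (hess f x)⁻¹ j i := by
  have h : (hess f x).transpose = hess f x := by
    ext i j
    exact hess_symm hf x j i
  rw [← Matrix.transpose_apply (hess f x)⁻¹, Matrix.transpose_nonsing_inv, h]

lemma differentiableAt_hess {n : ℕ} {f : Space n → ℝ} (hf : ContDiff ℝ ∞ f) (x : Space n)
    (i j : Fin n) : DifferentiableAt ℝ (fun y => hess f y i j) x := by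
  simpa only [hess_eq_pderiv] using differentiableAt_pderiv hf ![i, j] x

lemma fderiv_hess {n : ℕ} {f : Space n → ℝ} (hf : ContDiff ℝ ∞ f) (x : Space n)
    (i j a : Fin n) : fderiv ℝ (fun y => hess f y i j) x (e a) = pderiv f ![a, i, j] x := by
  simp only [hess_eq_pderiv]
  exact fderiv_pderiv hf ![i, j] x a

lemma fderiv_momentum {n : ℕ} {f : Space n → ℝ} (hf : ContDiff ℝ ∞ f) (x : Space n)
    (i a : Fin n) : fderiv ℝ (fun y => momentum f y i) x (e a) = hess f x a i := by
  simp only [momentum_eq_pderiv, hess_eq_pderiv]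
  exact fderiv_pderiv hf ![i] x a

lemma differentiableAt_momentum {n : ℕ} {f : Space n → ℝ} (hf : ContDiff ℝ ∞ f) (x : Space n)
    (i : Fin n) : DifferentiableAt ℝ (fun y => momentum f y i) x := by
  simpa only [momentum_eq_pderiv] using differentiableAt_pderiv hf ![i] x

/-- The moment formulas hold only where the Hessian is invertible; openness of this set allows them
to be differentiated. -/
lemma eventually_hess_det_ne {n : ℕ} {f : Space n → ℝ} (hf : ContDiff ℝ ∞ f) {x : Space n}
    (h : (hess f x).det ≠ 0) : ∀ᶠ y in nhds x, (hess f y).det ≠ 0 := by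
  have hc : Continuous fun y => (hess f y).det :=
    Continuous.matrix_det (continuous_pi fun i => continuous_pi fun j =>
      continuous_iff_continuousAt.2 fun y => (differentiableAt_hess hf y i j).continuousAt)
  exact hc.continuousAt.eventually_ne h

/-! ### Functions of jets and their derivatives -/

/-- Smooth functions on `V`. -/
abbrev SmoothFun (n : ℕ) : Type := {f : Space n → ℝ // ContDiff ℝ ∞ f}

/-- The algebra generated by `x - c`, the partial derivatives of `f` at `x` of orders `1` to `m`
and the inverse of the Hessian determinant, as functions of `(f, c, x)`. -/
noncomputable def jetExpr (n m : ℕ) : Subalgebra ℝ (SmoothFun n × Space n × Space n → ℝ) :=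
  Algebra.adjoin ℝ ({F | ∃ i, F = fun p => p.2.2 i - p.2.1 i} ∪
    {F | ∃ (k : ℕ) (τ : Fin k → Fin n), 1 ≤ k ∧ k ≤ m ∧ F = fun p => pderiv p.1.1 τ p.2.2} ∪
    {fun p => (hess p.1.1 p.2.2).det⁻¹})

section jetExpr

variable {n : ℕ}

lemma jetExpr_mono {m m' : ℕ} (h : m ≤ m') : jetExpr n m ≤ jetExpr n m' := by
  apply Algebra.adjoin_mono
  rintro F ((h' | ⟨k, τ, h1, h2, h3⟩) | h')
  · exact Or.inl (Or.inl h')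
  · exact Or.inl (Or.inr ⟨k, τ, h1, h2.trans h, h3⟩)
  · exact Or.inr h'

lemma sub_mem_jetExpr (m : ℕ) (i : Fin n) :
    (fun p => p.2.2 i - p.2.1 i) ∈ jetExpr n m :=
  Algebra.subset_adjoin (Or.inl (Or.inl ⟨i, rfl⟩))

lemma pderiv_mem_jetExpr {m k : ℕ} (τ : Fin k → Fin n) (h1 : 1 ≤ k) (h2 : k ≤ m) :
    (fun p => pderiv p.1.1 τ p.2.2) ∈ jetExpr n m :=
  Algebra.subset_adjoin (Or.inl (Or.inr ⟨k, τ, h1, h2, rfl⟩))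

lemma hess_mem_jetExpr {m : ℕ} (hm : 2 ≤ m) (i j : Fin n) :
    (fun p => hess p.1.1 p.2.2 i j) ∈ jetExpr n m := by
  simp only [hess_eq_pderiv]
  exact pderiv_mem_jetExpr _ (by norm_num) hm

lemma det_inv_mem_jetExpr (m : ℕ) :
    (fun p => (hess p.1.1 p.2.2).det⁻¹) ∈ jetExpr n m :=
  Algebra.subset_adjoin (Or.inr rfl)

end jetExpr

/-! ### Determinants and inverse matrices within subalgebras of functions -/

/-- A determinant lies in any subalgebra of functions containing the entries. -/
lemma det_mem_subalgebra {Ω m : Type*} [Fintype m] [DecidableEq m] (S : Subalgebra ℝ (Ω → ℝ))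
    (M : Ω → Matrix m m ℝ) (h : ∀ i j, (fun p => M p i j) ∈ S) : (fun p => (M p).det) ∈ S := by
  have : (fun p => (M p).det) = ∑ s : Equiv.Perm m, (Equiv.Perm.sign s : ℤ) •
      ∏ i, (fun p => M p (s i) i) := by
    ext p
    simp [Matrix.det_apply, Units.smul_def]
  rw [this]
  exact S.sum_mem fun s _ => S.zsmul_mem (S.prod_mem fun i _ => h _ _) _

lemma adjugate_mem_subalgebra {Ω m : Type*} [Fintype m] [DecidableEq m] (S : Subalgebra ℝ (Ω → ℝ))
    (M : Ω → Matrix m m ℝ) (h : ∀ i j, (fun p => M p i j) ∈ S) (i j : m) :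
    (fun p => (M p).adjugate i j) ∈ S := by
  simp only [Matrix.adjugate_apply]
  refine det_mem_subalgebra S (fun p => (M p).updateRow j (Pi.single i 1)) fun a b => ?_
  by_cases ha : a = j
  · subst ha
    simp only [Matrix.updateRow_self]
    exact S.algebraMap_mem _
  · simp only [Matrix.updateRow_ne ha]
    exact h a b

lemma inv_mem_subalgebra {Ω m : Type*} [Fintype m] [DecidableEq m] (S : Subalgebra ℝ (Ω → ℝ))
    (M : Ω → Matrix m m ℝ) (h : ∀ i j, (fun p => M p i j) ∈ S)
    (h' : (fun p => (M p).det⁻¹) ∈ S) (i j : m) : (fun p => (M p)⁻¹ i j) ∈ S := by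
  have : (fun p => (M p)⁻¹ i j) = (fun p => (M p).det⁻¹) * fun p => (M p).adjugate i j := by
    ext p
    simp [Matrix.inv_def]
  rw [this]
  exact S.mul_mem h' (adjugate_mem_subalgebra S M h i j)

lemma hess_inv_mem_jetExpr {n m : ℕ} (hm : 2 ≤ m) (i j : Fin n) :
    (fun p => (hess p.1.1 p.2.2)⁻¹ i j) ∈ jetExpr n m :=
  inv_mem_subalgebra _ _ (hess_mem_jetExpr hm) (det_inv_mem_jetExpr m) i j

/-- `F` is differentiable in `x` where the Hessian is invertible, with partial derivatives
`F' a`. -/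
def HasPartials {n : ℕ} (F : SmoothFun n × Space n × Space n → ℝ)
    (F' : Fin n → SmoothFun n × Space n × Space n → ℝ) : Prop :=
  ∀ (f : SmoothFun n) (c x : Space n), (hess f.1 x).det ≠ 0 →
    DifferentiableAt ℝ (fun y => F (f, c, y)) x ∧
      ∀ a, fderiv ℝ (fun y => F (f, c, y)) x (e a) = F' a (f, c, x)

namespace HasPartials

variable {n : ℕ} {F G : SmoothFun n × Space n × Space n → ℝ}
  {F' G' : Fin n → SmoothFun n × Space n × Space n → ℝ}

lemma const (r : ℝ) : HasPartials (n := n) (fun _ => r) (fun _ _ => 0) := fun f c x _ =>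
  ⟨by fun_prop, fun a => by simp⟩

lemma add (hF : HasPartials F F') (hG : HasPartials G G') :
    HasPartials (F + G) (fun a => F' a + G' a) := fun f c x h => by
  obtain ⟨h1, h2⟩ := hF f c x h
  obtain ⟨h3, h4⟩ := hG f c x h
  refine ⟨h1.add h3, fun a => ?_⟩
  have := fderiv_add h1 h3
  simp only [Pi.add_def] at this ⊢
  rw [this]
  simp [h2, h4]

lemma neg (hF : HasPartials F F') : HasPartials (-F) (fun a => -F' a) := fun f c x h => by
  obtain ⟨h1, h2⟩ := hF f c x h
  refine ⟨h1.neg, fun a => ?_⟩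
  have := fderiv_neg (𝕜 := ℝ) (f := fun y => F (f, c, y)) (x := x)
  simp only [Pi.neg_def] at this ⊢
  rw [this]
  simp [h2]

lemma sum {ι : Type*} (s : Finset ι) {F : ι → SmoothFun n × Space n × Space n → ℝ}
    {F' : ι → Fin n → SmoothFun n × Space n × Space n → ℝ}
    (hF : ∀ i ∈ s, HasPartials (F i) (F' i)) :
    HasPartials (fun p => ∑ i ∈ s, F i p) (fun a p => ∑ i ∈ s, F' i a p) := fun f c x h => by
  refine ⟨DifferentiableAt.fun_sum fun i hi => (hF i hi f c x h).1, fun a => ?_⟩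
  rw [fderiv_fun_sum fun i hi => (hF i hi f c x h).1, sum_apply]
  exact Finset.sum_congr rfl fun i hi => (hF i hi f c x h).2 a

lemma mul (hF : HasPartials F F') (hG : HasPartials G G') :
    HasPartials (F * G) (fun a => F * G' a + G * F' a) := fun f c x h => by
  obtain ⟨h1, h2⟩ := hF f c x h
  obtain ⟨h3, h4⟩ := hG f c x h
  refine ⟨h1.mul h3, fun a => ?_⟩
  have := fderiv_mul h1 h3
  simp only [Pi.mul_def, Pi.add_def] at this ⊢
  rw [this]
  simp [h2, h4]

lemma inv (hF : HasPartials F F')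
    (h0 : ∀ (f : SmoothFun n) (c x : Space n), (hess f.1 x).det ≠ 0 → F (f, c, x) ≠ 0) :
    HasPartials F⁻¹ (fun a => -(F⁻¹ * F⁻¹ * F' a)) := fun f c x h => by
  obtain ⟨h1, h2⟩ := hF f c x h
  have h3 := (hasDerivAt_inv (h0 f c x h)).comp_hasFDerivAt x h1.hasFDerivAt
  refine ⟨h3.differentiableAt, fun a => ?_⟩
  have := h3.fderiv
  simp only [Pi.inv_def, Function.comp_def] at this ⊢
  rw [this]
  simp only [smul_apply, h2, smul_eq_mul, Pi.neg_apply, Pi.mul_apply]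
  rw [sq, mul_inv, neg_mul]

lemma pderiv {k : ℕ} (τ : Fin k → Fin n) : HasPartials (fun p => Measurement.pderiv p.1.1 τ p.2.2)
    (fun a p => Measurement.pderiv p.1.1 (Fin.cons a τ : Fin (k + 1) → Fin n) p.2.2) :=
  fun f _ x _ => ⟨differentiableAt_pderiv f.2 τ x, fun a => fderiv_pderiv f.2 τ x a⟩

lemma sub (i : Fin n) : HasPartials (fun p => p.2.2 i - p.2.1 i)
    (fun a _ => if a = i then 1 else 0) := fun f c x _ => by
  have h : HasFDerivAt (fun y : Space n => y i - c i)
      (ContinuousLinearMap.proj (R := ℝ) (φ := fun _ : Fin n => ℝ) i) x :=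
    (hasFDerivAt_apply i x).sub_const _
  refine ⟨h.differentiableAt, fun a => ?_⟩
  rw [h.fderiv]
  simp [e, Pi.single_apply, eq_comm]

end HasPartials

/-- The generating set is left free because two are needed: the generators of `jetExpr`, and the
Hessian entries alone, from which the determinant is built. -/
lemma exists_hasPartials_of_mem_adjoin {n m : ℕ}
    {s : Set (SmoothFun n × Space n × Space n → ℝ)} (hs : s ⊆ jetExpr n m)
    (h : ∀ F ∈ s, ∃ F', (∀ a, F' a ∈ jetExpr n m) ∧ HasPartials F F')
    {F : SmoothFun n × Space n × Space n → ℝ} (hF : F ∈ Algebra.adjoin ℝ s) :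
    ∃ F', (∀ a, F' a ∈ jetExpr n m) ∧ HasPartials F F' := by
  have hs' : Algebra.adjoin ℝ s ≤ jetExpr n m := Algebra.adjoin_le hs
  induction hF using Algebra.adjoin_induction with
  | mem F hF => exact h F hF
  | algebraMap r => exact ⟨_, fun a => Subalgebra.zero_mem _, HasPartials.const r⟩
  | add F G hF hG h1 h2 =>
    obtain ⟨F', h1, h1'⟩ := h1
    obtain ⟨G', h2, h2'⟩ := h2
    exact ⟨_, fun a => Subalgebra.add_mem _ (h1 a) (h2 a), h1'.add h2'⟩
  | mul F G hF hG h1 h2 =>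
    obtain ⟨F', h1, h1'⟩ := h1
    obtain ⟨G', h2, h2'⟩ := h2
    exact ⟨_, fun a => Subalgebra.add_mem _ (Subalgebra.mul_mem _ (hs' hF) (h2 a))
      (Subalgebra.mul_mem _ (hs' hG) (h1 a)), h1'.mul h2'⟩

/-- The total derivatives of a function of `m`-jets are functions of `(m + 1)`-jets. -/
lemma exists_hasPartials {n m : ℕ} (hm : 2 ≤ m) {F : SmoothFun n × Space n × Space n → ℝ}
    (hF : F ∈ jetExpr n m) : ∃ F', (∀ a, F' a ∈ jetExpr n (m + 1)) ∧ HasPartials F F' := by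
  refine exists_hasPartials_of_mem_adjoin
    (Algebra.subset_adjoin.trans (jetExpr_mono (Nat.le_succ m))) ?_ hF
  rintro F ((⟨i, rfl⟩ | ⟨k, τ, h1, h2, rfl⟩) | rfl)
  · exact ⟨_, fun a => Subalgebra.algebraMap_mem _ (if a = i then (1 : ℝ) else 0),
      HasPartials.sub i⟩
  · exact ⟨_, fun a => pderiv_mem_jetExpr _ (by omega) (by omega), HasPartials.pderiv τ⟩
  -- The determinant is a polynomial in the second derivatives, and its inverse is differentiated as
  -- a reciprocal.
  · have hdet : (fun p : SmoothFun n × Space n × Space n => (hess p.1.1 p.2.2).det) ∈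
        Algebra.adjoin ℝ (Set.range fun q : Fin n × Fin n =>
          fun p : SmoothFun n × Space n × Space n => hess p.1.1 p.2.2 q.1 q.2) :=
      det_mem_subalgebra _ _ fun i j => Algebra.subset_adjoin ⟨(i, j), rfl⟩
    obtain ⟨F', h1, h2⟩ := exists_hasPartials_of_mem_adjoin (m := m + 1) (by
      rintro _ ⟨q, rfl⟩
      exact hess_mem_jetExpr (by omega) _ _) (by
      rintro _ ⟨q, rfl⟩
      simp only [hess_eq_pderiv]
      exact ⟨_, fun a => pderiv_mem_jetExpr _ (by omega) (by omega), HasPartials.pderiv _⟩) hdet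
    exact ⟨_, fun a => Subalgebra.neg_mem _ (Subalgebra.mul_mem _ (Subalgebra.mul_mem _
      (det_inv_mem_jetExpr _) (det_inv_mem_jetExpr _)) (h1 a)), h2.inv fun f c x h => h⟩

/-! ### Moments in terms of jets -/

/-- The identity H H⁻¹ = 1 holds near `x`; differentiating it and solving for the derivative of H⁻¹
gives the formula. -/
lemma hess_inv_hasPartials {n : ℕ} (i j : Fin n) :
    HasPartials (fun p => (hess p.1.1 p.2.2)⁻¹ i j)
      (fun a p => -∑ b, ∑ d, (hess p.1.1 p.2.2)⁻¹ i b * pderiv p.1.1 ![a, b, d] p.2.2 *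
        (hess p.1.1 p.2.2)⁻¹ d j) := by
  intro f c x h
  have hd : ∀ i j, DifferentiableAt ℝ (fun y => (hess f.1 y)⁻¹ i j) x := fun i j => by
    obtain ⟨_, _, h2⟩ := exists_hasPartials le_rfl (hess_inv_mem_jetExpr (n := n) le_rfl i j)
    exact (h2 f c x h).1
  refine ⟨hd i j, fun a => ?_⟩
  have key : ∀ b, ∑ d, pderiv f.1 ![a, b, d] x * (hess f.1 x)⁻¹ d j +
      ∑ d, hess f.1 x b d * fderiv ℝ (fun y => (hess f.1 y)⁻¹ d j) x (e a) = 0 := fun b => by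
    have h1 : (fun y => ∑ d, hess f.1 y b d * (hess f.1 y)⁻¹ d j) =ᶠ[nhds x]
        fun _ => (1 : Matrix (Fin n) (Fin n) ℝ) b j := by
      filter_upwards [eventually_hess_det_ne f.2 h] with y hy
      rw [← Matrix.mul_apply, Matrix.mul_nonsing_inv _ (isUnit_iff_ne_zero.2 hy)]
    have h2 := h1.fderiv_eq (𝕜 := ℝ)
    rw [fderiv_fun_sum (𝕜 := ℝ) (u := Finset.univ)
      (A := fun d y => hess f.1 y b d * (hess f.1 y)⁻¹ d j)
      (fun d _ => (differentiableAt_hess f.2 x b d).mul (hd d j))] at h2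
    have h3 := congrArg (fun L : Space n →L[ℝ] ℝ => L (e a)) h2
    simp only [fderiv_fun_mul (differentiableAt_hess f.2 x _ _) (hd _ _)] at h3
    simp only [sum_apply, add_apply,
      smul_apply, fderiv_hess f.2, smul_eq_mul, fderiv_const_apply,
      zero_apply, Finset.sum_add_distrib] at h3
    rw [add_comm, ← h3]
    congr 1
    exact Finset.sum_congr rfl fun d _ => mul_comm _ _
  have h4 : ∑ b, (hess f.1 x)⁻¹ i b *
      ∑ d, hess f.1 x b d * fderiv ℝ (fun y => (hess f.1 y)⁻¹ d j) x (e a) =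
      fderiv ℝ (fun y => (hess f.1 y)⁻¹ i j) x (e a) := by
    have h5 := congrFun (Matrix.mulVec_mulVec
      (fun d => fderiv ℝ (fun y => (hess f.1 y)⁻¹ d j) x (e a)) (hess f.1 x)⁻¹ (hess f.1 x)) i
    rw [Matrix.nonsing_inv_mul _ (isUnit_iff_ne_zero.2 h), Matrix.one_mulVec] at h5
    exact h5
  simp only
  rw [← h4, ← Finset.sum_neg_distrib]
  refine Finset.sum_congr rfl fun b _ => ?_
  rw [eq_neg_of_add_eq_zero_right (key b), mul_neg, Finset.mul_sum]
  congr 1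
  exact Finset.sum_congr rfl fun d _ => by ring

lemma partitionFunction_pos {n : ℕ} (f : Space n → ℝ) (c x : Space n) :
    0 < partitionFunction f c x := mul_pos (Real.exp_pos _) (Real.exp_pos _)

lemma partitionFunction_eq {n : ℕ} (f : Space n → ℝ) (c y : Space n) :
    partitionFunction f c y = Real.exp (∑ i, momentum f y i * (y i - c i) - f y) := by
  rw [partitionFunction, ← Real.exp_add]
  congr 1
  simp only [mul_sub, Finset.sum_sub_distrib]
  ring

/-- Legendre duality: in d(⟨λ, x - c⟩ - f) the term ⟨λ, dx⟩ cancels against df, leaving ⟨dλ, x - c⟩.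
-/
lemma hasFDerivAt_partitionFunction {n : ℕ} {f : Space n → ℝ} (hf : ContDiff ℝ ∞ f)
    (c x : Space n) : DifferentiableAt ℝ (partitionFunction f c) x ∧
      ∀ a, fderiv ℝ (partitionFunction f c) x (e a) =
        (∑ i, hess f x a i * (x i - c i)) * partitionFunction f c x := by
  have hp : partitionFunction f c =
      fun y => Real.exp (∑ i, momentum f y i * (y i - c i) - f y) :=
    funext (partitionFunction_eq f c)
  have hc : ∀ i, HasFDerivAt (fun y : Space n => y i - c i)
      (ContinuousLinearMap.proj (R := ℝ) (φ := fun _ : Fin n => ℝ) i) x := fun i =>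
    (hasFDerivAt_apply i x).sub_const _
  have hs := HasFDerivAt.fun_sum (u := Finset.univ) fun i _ =>
    (differentiableAt_momentum hf x i).hasFDerivAt.mul (hc i)
  have hfx := ((hf.differentiable (by simp)) x).hasFDerivAt
  have he := (hs.sub hfx).exp
  rw [hp]
  refine ⟨he.differentiableAt, fun a => ?_⟩
  erw [he.fderiv]
  have hm : fderiv ℝ f x (Pi.single a 1) = momentum f x a := rfl
  have hm' : ∀ i, fderiv ℝ (fun y => momentum f y i) x (Pi.single a 1) = hess f x a i :=
    fun i => fderiv_momentum hf x i a
  simp [Finset.sum_add_distrib, e, Pi.single_apply]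
  rw [hm, Finset.sum_congr rfl fun i _ => congrArg _ (hm' i)]
  rw [add_sub_cancel_left, mul_comm]
  congr 1
  exact Finset.sum_congr rfl fun i _ => mul_comm _ _

/-- The derivative `Z_{λ_{τ 0} ⋯ λ_{τ (k-1)}}` of the partition function is `F * Z` where the
Hessian is invertible. -/
def IsMomentExpr {n k : ℕ} (τ : Fin k → Fin n) (F : SmoothFun n × Space n × Space n → ℝ) : Prop :=
  ∀ (f : SmoothFun n) (c x : Space n), (hess f.1 x).det ≠ 0 →
    (List.ofFn τ).foldr (dLambda f.1) (partitionFunction f.1 c) x =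
      F (f, c, x) * partitionFunction f.1 c x

lemma isMomentExpr_zero {n : ℕ} (τ : Fin 0 → Fin n) : IsMomentExpr τ (fun _ => 1) :=
  fun f c x _ => by simp

/-- The recursion for the moments. -/
lemma IsMomentExpr.cons {n k : ℕ} {τ : Fin k → Fin n}
    {F : SmoothFun n × Space n × Space n → ℝ} {F' : Fin n → SmoothFun n × Space n × Space n → ℝ}
    (h : IsMomentExpr τ F) (hF : HasPartials F F') (j : Fin n) :
    IsMomentExpr (Fin.cons j τ : Fin (k + 1) → Fin n)
      (fun p => ∑ a, (hess p.1.1 p.2.2)⁻¹ a j * F' a p + (p.2.2 j - p.2.1 j) * F p) := by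
  intro f c x hx
  have h1 : (List.ofFn τ).foldr (dLambda f.1) (partitionFunction f.1 c) =ᶠ[nhds x]
      fun y => F (f, c, y) * partitionFunction f.1 c y := by
    filter_upwards [eventually_hess_det_ne f.2 hx] with y hy
    exact h f c y hy
  obtain ⟨h2, h3⟩ := hasFDerivAt_partitionFunction f.2 c x
  obtain ⟨h4, h5⟩ := hF f c x hx
  -- Passing from ∂/∂x to ∂/∂λ cancels the Hessian, so ∂Z/∂λ_j = (x_j - c_j) Z.
  have h6 : ∑ a, (hess f.1 x)⁻¹ a j * ∑ i, hess f.1 x a i * (x i - c i) = x j - c j := by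
    have h7 := congrFun (Matrix.mulVec_mulVec (x - c) (hess f.1 x)⁻¹ (hess f.1 x)) j
    rw [Matrix.nonsing_inv_mul _ (isUnit_iff_ne_zero.2 hx), Matrix.one_mulVec] at h7
    simp only [hess_inv_symm f.2 x _ j]
    exact h7
  rw [List.ofFn_succ]
  simp only [Fin.cons_zero, Fin.cons_succ, List.foldr_cons]
  rw [dLambda, h1.fderiv_eq, fderiv_fun_mul h4 h2]
  simp only [add_apply, smul_apply, smul_eq_mul, h3, h5]
  rw [← h6, add_mul, Finset.sum_mul, Finset.sum_mul, Finset.sum_mul, ← Finset.sum_add_distrib]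
  exact Finset.sum_congr rfl fun a _ => by ring

/-- Only the values where the Hessian is invertible matter for a moment expression. -/
lemma IsMomentExpr.congr {n k : ℕ} {τ : Fin k → Fin n}
    {F G : SmoothFun n × Space n × Space n → ℝ} (h : IsMomentExpr τ F)
    (hFG : ∀ (f : SmoothFun n) (c x : Space n), (hess f.1 x).det ≠ 0 →
      F (f, c, x) = G (f, c, x)) : IsMomentExpr τ G := fun f c x hx => by
  rw [h f c x hx, hFG f c x hx]

/-- The order bound `k + 2` is not sharp; the lemma serves to show that the iterated λ-derivatives
of the partition function are differentiable. -/
lemma exists_isMomentExpr {n k : ℕ} (τ : Fin k → Fin n) :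
    ∃ F ∈ jetExpr n (k + 2), IsMomentExpr τ F := by
  induction k with
  | zero => exact ⟨_, Subalgebra.one_mem _, isMomentExpr_zero τ⟩
  | succ k ih =>
    obtain ⟨F, h1, h2⟩ := ih (Fin.tail τ)
    obtain ⟨F', h3, h4⟩ := exists_hasPartials (by omega) h1
    have h5 := h2.cons h4 (τ 0)
    rw [Fin.cons_self_tail] at h5
    refine ⟨_, Subalgebra.add_mem _ ?_ (Subalgebra.mul_mem _ (sub_mem_jetExpr _ _)
      (jetExpr_mono (Nat.le_succ _) h1)), h5⟩
    have := Subalgebra.sum_mem (jetExpr n (k + 2 + 1)) (t := Finset.univ) fun a _ =>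
      Subalgebra.mul_mem _ (hess_inv_mem_jetExpr (by omega) a (τ 0)) (h3 a)
    convert this using 1
    ext p
    simp

lemma isMomentExpr_one {n : ℕ} (i : Fin n) : IsMomentExpr ![i] (fun p => p.2.2 i - p.2.1 i) :=
  ((isMomentExpr_zero ![]).cons (HasPartials.const 1) i).congr fun f c x _ => by simp

lemma isMomentExpr_two {n : ℕ} (i j : Fin n) : IsMomentExpr ![i, j]
    (fun p => (hess p.1.1 p.2.2)⁻¹ j i + (p.2.2 i - p.2.1 i) * (p.2.2 j - p.2.1 j)) :=
  ((isMomentExpr_one j).cons (HasPartials.sub j) i).congr fun f c x _ => by simp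

/-- The leading term of the moments. -/
noncomputable def leadingTerm {n k : ℕ} (τ : Fin k → Fin n) (p : SmoothFun n × Space n × Space n) :
    ℝ :=
  ∑ ρ : Fin k → Fin n, (∏ r, (hess p.1.1 p.2.2)⁻¹ (ρ r) (τ r)) * pderiv p.1.1 ρ p.2.2

lemma sum_fin_succ_pi {n k : ℕ} (G : (Fin (k + 1) → Fin n) → ℝ) :
    ∑ ρ, G ρ = ∑ a, ∑ ρ : Fin k → Fin n, G (Fin.cons a ρ) := by
  rw [← Fintype.sum_prod_type', ← (Fin.consEquiv fun _ : Fin (k + 1) => Fin n).sum_comp]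
  rfl

/-- Each ∂/∂λ_j raises the order of the top derivative by one and contributes one factor H⁻¹; all
other terms have lower order. The minus sign comes from differentiating H⁻¹ at order three, where
every remaining term carries a factor x - c, whence the last clause. -/
lemma exists_isMomentExpr_leadingTerm {n m : ℕ} (τ : Fin (m + 3) → Fin n) :
    ∃ F ∈ jetExpr n (m + 2), IsMomentExpr τ (fun p => -leadingTerm τ p + F p) ∧
      (m = 0 → ∀ f x, F (f, x, x) = 0) := by
  induction m with
  | zero =>
    have hτ : τ = Fin.cons (τ 0) ![τ 1, τ 2] := by
      ext r; fin_cases r <;> rfl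
    have h := (isMomentExpr_two (τ 1) (τ 2)).cons
      (((hess_inv_hasPartials _ _).add ((HasPartials.sub _).mul (HasPartials.sub _)))) (τ 0)
    rw [← hτ] at h
    refine ⟨fun p => (hess p.1.1 p.2.2)⁻¹ (τ 1) (τ 0) * (p.2.2 (τ 2) - p.2.1 (τ 2)) +
      (hess p.1.1 p.2.2)⁻¹ (τ 2) (τ 0) * (p.2.2 (τ 1) - p.2.1 (τ 1)) +
      (p.2.2 (τ 0) - p.2.1 (τ 0)) * ((hess p.1.1 p.2.2)⁻¹ (τ 2) (τ 1) +
        (p.2.2 (τ 1) - p.2.1 (τ 1)) * (p.2.2 (τ 2) - p.2.1 (τ 2))), ?_, h.congr ?_, ?_⟩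
    · have hg := fun i j => hess_inv_mem_jetExpr (n := n) le_rfl i j
      have hs := fun i => sub_mem_jetExpr (n := n) 2 i
      exact Subalgebra.add_mem _ (Subalgebra.add_mem _ (Subalgebra.mul_mem _ (hg _ _) (hs _))
        (Subalgebra.mul_mem _ (hg _ _) (hs _))) (Subalgebra.mul_mem _ (hs _)
          (Subalgebra.add_mem _ (hg _ _) (Subalgebra.mul_mem _ (hs _) (hs _))))
    · intro f c x _
      have hl : leadingTerm τ (f, c, x) = ∑ a, (hess f.1 x)⁻¹ a (τ 0) * ∑ b, ∑ d,
          (hess f.1 x)⁻¹ (τ 2) b * pderiv f.1 ![a, b, d] x * (hess f.1 x)⁻¹ d (τ 1) := by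
        simp only [leadingTerm, sum_fin_succ_pi, Fin.prod_univ_succ, Finset.mul_sum]
        refine Finset.sum_congr rfl fun a _ => ?_
        rw [Finset.sum_comm]
        refine Finset.sum_congr rfl fun b _ => Finset.sum_congr rfl fun d _ => ?_
        -- The derivative of the entry (τ 2, τ 1) of H⁻¹ lists the two inner indices in reverse
        -- order.
        have hp : pderiv f.1 ![a, b, d] x = pderiv f.1 ![a, d, b] x := by
          rw [← pderiv_comp_perm f.2 _ (Equiv.swap 1 2)]
          congr 1
          ext r; fin_cases r <;> rfl
        have hc : ∀ ρ : Fin 0 → Fin n,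
            (Fin.cons a (Fin.cons d (Fin.cons b ρ : Fin 1 → Fin n) : Fin 2 → Fin n) :
              Fin 3 → Fin n) = ![a, d, b] := fun ρ => by
          ext r; fin_cases r <;> rfl
        rw [hp, hess_inv_symm f.2 x (τ 2) b]
        simp [hc]
        ring
      rw [hl]
      simp [mul_add, Finset.sum_add_distrib]
      ring
    · intro _ f x
      simp
  | succ m ih =>
    obtain ⟨F, h1, h2, -⟩ := ih (Fin.tail τ)
    obtain ⟨F', h3, h4⟩ := exists_hasPartials (by omega) h1
    have hprod : ∀ ρ : Fin (m + 3) → Fin n,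
        (fun p => ∏ r, (hess p.1.1 p.2.2)⁻¹ (ρ r) (Fin.tail τ r)) ∈ jetExpr n 2 := fun ρ => by
      have := Subalgebra.prod_mem (jetExpr n 2) (t := Finset.univ) fun r _ =>
        hess_inv_mem_jetExpr le_rfl (ρ r) (Fin.tail τ r)
      convert this using 1
      ext p
      simp
    -- The factors H⁻¹ depend on 2-jets, so their derivatives have order at most 3, below the new
    -- top order m + 4.
    choose G' hG1 hG2 using fun ρ : Fin (m + 3) → Fin n => exists_hasPartials le_rfl (hprod ρ)
    have hlead : HasPartials (leadingTerm (Fin.tail τ)) _ :=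
      HasPartials.sum Finset.univ fun ρ _ => (hG2 ρ).mul (HasPartials.pderiv ρ)
    have hcons := h2.cons (hlead.neg.add h4) (τ 0)
    rw [Fin.cons_self_tail] at hcons
    have hg := fun i j => hess_inv_mem_jetExpr (n := n) (m := m + 1 + 2) (by omega) i j
    have hu := fun ρ : Fin (m + 3) → Fin n => pderiv_mem_jetExpr (m := m + 1 + 2) ρ (by omega) le_rfl
    refine ⟨∑ a, (fun p => (hess p.1.1 p.2.2)⁻¹ a (τ 0)) *
        (-(∑ ρ, (fun p => pderiv p.1.1 ρ p.2.2) * G' ρ a) + F' a) +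
      (fun p => p.2.2 (τ 0) - p.2.1 (τ 0)) * (-(∑ ρ : Fin (m + 3) → Fin n,
        (fun p => ∏ r, (hess p.1.1 p.2.2)⁻¹ (ρ r) (Fin.tail τ r)) *
          fun p => pderiv p.1.1 ρ p.2.2) + F), ?_, hcons.congr ?_, fun h => by omega⟩
    · refine Subalgebra.add_mem _ (Subalgebra.sum_mem _ fun a _ => Subalgebra.mul_mem _ (hg _ _)
        (Subalgebra.add_mem _ (Subalgebra.neg_mem _ (Subalgebra.sum_mem _ fun ρ _ =>
          Subalgebra.mul_mem _ (hu ρ) (jetExpr_mono (by omega) (hG1 ρ a)))) (h3 a)))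
        (Subalgebra.mul_mem _ (sub_mem_jetExpr _ _) (Subalgebra.add_mem _ (Subalgebra.neg_mem _
          (Subalgebra.sum_mem _ fun ρ _ => Subalgebra.mul_mem _
            (jetExpr_mono (by omega) (hprod ρ)) (hu ρ))) (jetExpr_mono (by omega) h1)))
    · intro f c x _
      have hl : leadingTerm τ (f, c, x) = ∑ a, (hess f.1 x)⁻¹ a (τ 0) *
          ∑ ρ : Fin (m + 3) → Fin n, (∏ r, (hess f.1 x)⁻¹ (ρ r) (Fin.tail τ r)) *
            pderiv f.1 (Fin.cons a ρ : Fin (m + 4) → Fin n) x := by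
        rw [leadingTerm, sum_fin_succ_pi]
        refine Finset.sum_congr rfl fun a _ => ?_
        rw [Finset.mul_sum]
        refine Finset.sum_congr rfl fun ρ _ => ?_
        rw [Fin.prod_univ_succ]
        simp [Fin.tail, mul_assoc]
      rw [hl]
      simp only [leadingTerm, Pi.add_apply, Pi.neg_apply, Pi.mul_apply, Finset.sum_apply,
        Finset.sum_add_distrib, mul_add, mul_neg, neg_add, Finset.sum_neg_distrib]
      ring

/-! ### Central moments in terms of jets -/

lemma moment_eq {n k : ℕ} {τ : Fin k → Fin n} {F : SmoothFun n × Space n × Space n → ℝ}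
    (h : IsMomentExpr τ F) (f : SmoothFun n) (c x : Space n) (hx : (hess f.1 x).det ≠ 0) :
    moment f.1 c τ x = F (f, c, x) := by
  rw [moment, h f c x hx, mul_div_cancel_right₀ _ (partitionFunction_pos f.1 c x).ne']

/-- This is the first moment x - c at c = 0; central moments are therefore moments evaluated at c =
x. -/
lemma mean_eq {n : ℕ} (f : SmoothFun n) (x : Space n) (hx : (hess f.1 x).det ≠ 0) :
    mean f.1 x = x := by
  ext i
  rw [mean, moment_eq (isMomentExpr_one i) f 0 x hx]
  simp

lemma centralMoment_eq {n k : ℕ} {τ : Fin k → Fin n} {F : SmoothFun n × Space n × Space n → ℝ}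
    (h : IsMomentExpr τ F) (f : SmoothFun n) (x : Space n) (hx : (hess f.1 x).det ≠ 0) :
    centralMoment f.1 τ x = F (f, x, x) := by
  rw [centralMoment, mean_eq f x hx, moment_eq h f x x hx]

/-- Components of `σ_k` with respect to the `∂/∂x^i`. -/
noncomputable def sigmaCoord {n k : ℕ} (f : Space n → ℝ) (x : Space n) (τ : Fin k → Fin n) : ℝ :=
  sigma f x (fun r => e (τ r))

lemma mulVec_e {n : ℕ} (M : Matrix (Fin n) (Fin n) ℝ) (a b : Fin n) :
    M.mulVec (e a) b = M b a := by
  simp [e]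

lemma sigmaCoord_eq {n k : ℕ} (f : Space n → ℝ) (x : Space n) (τ : Fin k → Fin n) :
    sigmaCoord f x τ = ∑ ρ : Fin k → Fin n, centralMoment f ρ x * ∏ r, hess f x (ρ r) (τ r) := by
  simp only [sigmaCoord, sigma, mulVec_e]

lemma sigma_expand {n k : ℕ} (f : Space n → ℝ) (x : Space n) (w : Fin k → Space n) :
    sigma f x w = ∑ τ : Fin k → Fin n, sigmaCoord f x τ * ∏ r, w r (τ r) := by
  simp only [sigmaCoord_eq, sigma, Matrix.mulVec, dotProduct, Fintype.prod_sum, Finset.mul_sum,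
    Finset.sum_mul]
  rw [Finset.sum_comm]
  refine Finset.sum_congr rfl fun τ _ => Finset.sum_congr rfl fun ρ _ => ?_
  rw [Finset.prod_mul_distrib, mul_assoc]

/-- Passing from the dλ_i to the dx^i multiplies each slot by the Hessian, which cancels every H⁻¹
of the leading term. -/
lemma sum_leadingTerm {n k : ℕ} (f : SmoothFun n) (x : Space n) (hx : (hess f.1 x).det ≠ 0)
    (τ : Fin k → Fin n) :
    ∑ ρ : Fin k → Fin n, leadingTerm ρ (f, x, x) * ∏ r, hess f.1 x (ρ r) (τ r) =
      pderiv f.1 τ x := by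
  simp only [leadingTerm, Finset.sum_mul]
  rw [Finset.sum_comm]
  have h : ∀ κ : Fin k → Fin n, ∑ ρ : Fin k → Fin n,
      (∏ r, (hess f.1 x)⁻¹ (κ r) (ρ r)) * pderiv f.1 κ x * ∏ r, hess f.1 x (ρ r) (τ r) =
      if κ = τ then pderiv f.1 κ x else 0 := fun κ => by
    have h1 : ∏ r, ∑ b, (hess f.1 x)⁻¹ (κ r) b * hess f.1 x b (τ r) =
        if κ = τ then 1 else 0 := by
      simp only [← Matrix.mul_apply, Matrix.nonsing_inv_mul _ (isUnit_iff_ne_zero.2 hx),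
        Matrix.one_apply, Finset.prod_ite_zero, Finset.prod_const_one, funext_iff,
        Finset.mem_univ, forall_true_left]
    rw [Fintype.prod_sum] at h1
    simp only [Finset.prod_mul_distrib] at h1
    have h2 := congrArg (fun t => t * pderiv f.1 κ x) h1
    simp only [ite_mul, one_mul, zero_mul, Finset.sum_mul] at h2
    rw [← h2]
    exact Finset.sum_congr rfl fun ρ _ => by ring
  simp [h]

/-- At c = x the second moment is H⁻¹, and lowering both indices gives H H⁻¹ H = H. -/
lemma sigmaCoord_two {n : ℕ} (f : SmoothFun n) (x : Space n) (hx : (hess f.1 x).det ≠ 0)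
    (τ : Fin 2 → Fin n) : sigmaCoord f.1 x τ = pderiv f.1 τ x := by
  have hτ : ∀ ρ : Fin 2 → Fin n, ρ = ![ρ 0, ρ 1] := fun ρ => by
    ext r; fin_cases r <;> rfl
  have hc : ∀ ρ : Fin 2 → Fin n, centralMoment f.1 ρ x = (hess f.1 x)⁻¹ (ρ 0) (ρ 1) := fun ρ => by
    conv_lhs => rw [hτ ρ]
    rw [centralMoment_eq (isMomentExpr_two _ _) f x hx, hess_inv_symm f.2]
    simp
  rw [sigmaCoord_eq]
  have h : (hess f.1 x * (hess f.1 x)⁻¹ * hess f.1 x) (τ 0) (τ 1) = hess f.1 x (τ 0) (τ 1) := by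
    rw [Matrix.mul_nonsing_inv (hess f.1 x) (isUnit_iff_ne_zero.2 hx), Matrix.one_mul]
  have hp : pderiv f.1 τ x = hess f.1 x (τ 0) (τ 1) := by
    rw [hess_eq_pderiv, ← hτ τ]
  rw [hp, ← h, sum_fin_succ_pi, Matrix.mul_assoc, Matrix.mul_apply]
  refine Finset.sum_congr rfl fun a _ => ?_
  rw [sum_fin_succ_pi, Matrix.mul_apply, Finset.mul_sum]
  refine Finset.sum_congr rfl fun b _ => ?_
  simp [hc, hess_symm f.2 x (τ 0) a]
  ring

/-- For `k ≥ 3`, `σ_k` is minus the tensor of `k`th derivatives up to lower order terms. -/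
lemma exists_sigmaCoord_add_pderiv {n m : ℕ} (τ : Fin (m + 3) → Fin n) :
    ∃ F ∈ jetExpr n (m + 2), (∀ (f : SmoothFun n) (x : Space n), (hess f.1 x).det ≠ 0 →
      sigmaCoord f.1 x τ = -pderiv f.1 τ x + F (f, x, x)) ∧
      (m = 0 → ∀ f x, F (f, x, x) = 0) := by
  choose F h1 h2 h3 using fun ρ : Fin (m + 3) → Fin n => exists_isMomentExpr_leadingTerm ρ
  have hh : ∀ a b, (fun p => hess p.1.1 p.2.2 a b) ∈ jetExpr n (m + 2) :=
    hess_mem_jetExpr (by omega)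
  refine ⟨∑ ρ : Fin (m + 3) → Fin n, F ρ *
    ∏ r : Fin (m + 3), fun p : SmoothFun n × Space n × Space n => hess p.1.1 p.2.2 (ρ r) (τ r),
    Subalgebra.sum_mem _ fun ρ _ => Subalgebra.mul_mem _ (h1 ρ)
      (Subalgebra.prod_mem _ fun r _ => hh _ _), ?_, ?_⟩
  · intro f x hx
    rw [← sum_leadingTerm f x hx, sigmaCoord_eq, ← Finset.sum_neg_distrib]
    simp only [Finset.sum_apply, Pi.mul_apply, Finset.prod_apply]
    rw [← Finset.sum_add_distrib]
    refine Finset.sum_congr rfl fun ρ _ => ?_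
    rw [centralMoment_eq (h2 ρ) f x hx]
    ring
  · intro hm f x
    simp [h3 _ hm f x]

lemma sigmaCoord_three {n : ℕ} (f : SmoothFun n) (x : Space n) (hx : (hess f.1 x).det ≠ 0)
    (τ : Fin 3 → Fin n) : sigmaCoord f.1 x τ = -pderiv f.1 τ x := by
  obtain ⟨F, -, h2, h3⟩ := exists_sigmaCoord_add_pderiv (m := 0) τ
  rw [h2 f x hx, h3 rfl, add_zero]

lemma sigmaTwo_eq {n : ℕ} (f : SmoothFun n) (x : Space n) (hx : (hess f.1 x).det ≠ 0) :
    sigmaTwo f.1 x = hess f.1 x := by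
  ext i j
  rw [hess_eq_pderiv, ← sigmaCoord_two f x hx, sigmaTwo, Matrix.of_apply, sigmaCoord]
  congr 1
  ext r : 1
  fin_cases r <;> rfl

/-! ### The algebra of functions of jets with nondegenerate Hessian -/

/-- Pairs `(f, x)` such that the Hessian of `f` at `x` is invertible. -/
abbrev Nondeg (n : ℕ) : Type := {p : SmoothFun n × Space n // (hess p.1.1 p.2).det ≠ 0}

/-- The inverse of the Hessian determinant. -/
noncomputable def detInv {n : ℕ} (p : Nondeg n) : ℝ := (hess p.1.1.1 p.1.2).det⁻¹

/-- Polynomials in the partial derivatives of orders `1` to `m` and the inverse of the Hessian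
determinant. -/
noncomputable def jetAlgebra (n m : ℕ) : Subalgebra ℝ (Nondeg n → ℝ) :=
  Algebra.adjoin ℝ ({F | ∃ (k : ℕ) (τ : Fin k → Fin n), 1 ≤ k ∧ k ≤ m ∧
    F = fun p => pderiv p.1.1.1 τ p.1.2} ∪ {detInv})

/-- Polynomials in the momenta, the components of `σ_k` for `2 ≤ k ≤ m` with weakly increasing
indices and the inverse of the Hessian determinant. -/
noncomputable def sigmaAlgebra (n m : ℕ) : Subalgebra ℝ (Nondeg n → ℝ) :=
  Algebra.adjoin ℝ ({F | ∃ i, F = fun p => pderiv p.1.1.1 ![i] p.1.2} ∪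
    {F | ∃ I : GenIndex n, I.1 + 2 ≤ m ∧ F = fun p => sigmaCoord p.1.1.1 p.1.2 I.2.1} ∪ {detInv})

section

variable {n : ℕ}

lemma jetAlgebra_mono {m m' : ℕ} (h : m ≤ m') : jetAlgebra n m ≤ jetAlgebra n m' := by
  refine Algebra.adjoin_mono (Set.union_subset_union_left _ ?_)
  rintro F ⟨k, τ, h1, h2, h3⟩
  exact ⟨k, τ, h1, h2.trans h, h3⟩

lemma sigmaAlgebra_mono {m m' : ℕ} (h : m ≤ m') : sigmaAlgebra n m ≤ sigmaAlgebra n m' := by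
  refine Algebra.adjoin_mono (Set.union_subset_union_left _ (Set.union_subset_union_right _ ?_))
  rintro F ⟨I, h1, h2⟩
  exact ⟨I, h1.trans h, h2⟩

lemma pderiv_mem_jetAlgebra {m k : ℕ} (τ : Fin k → Fin n) (h1 : 1 ≤ k) (h2 : k ≤ m) :
    (fun p => pderiv p.1.1.1 τ p.1.2) ∈ jetAlgebra n m :=
  Algebra.subset_adjoin (Or.inl ⟨k, τ, h1, h2, rfl⟩)

lemma detInv_mem_jetAlgebra (m : ℕ) : detInv ∈ jetAlgebra n m :=
  Algebra.subset_adjoin (Or.inr rfl)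

/-- Restriction of functions of `(f, c, x)` to `c = x`. -/
noncomputable def restrictDiag (n : ℕ) :
    (SmoothFun n × Space n × Space n → ℝ) →ₐ[ℝ] (Nondeg n → ℝ) :=
  AlgHom.pi fun p => Pi.evalAlgHom ℝ (fun _ => ℝ) (p.1.1, p.1.2, p.1.2)

/-- Once no differentiation remains, c may be set equal to x, which kills the generators x - c. -/
lemma restrictDiag_mem {m : ℕ} {F : SmoothFun n × Space n × Space n → ℝ} (hF : F ∈ jetExpr n m) :
    (fun p : Nondeg n => F (p.1.1, p.1.2, p.1.2)) ∈ jetAlgebra n m := by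
  have h : jetExpr n m ≤ (jetAlgebra n m).comap (restrictDiag n) := by
    refine Algebra.adjoin_le ?_
    rintro F ((⟨i, rfl⟩ | ⟨k, τ, h1, h2, rfl⟩) | rfl)
    · change (fun p : Nondeg n => p.1.2 i - p.1.2 i) ∈ jetAlgebra n m
      simp only [sub_self]
      exact Subalgebra.zero_mem _
    · exact pderiv_mem_jetAlgebra τ h1 h2
    · exact detInv_mem_jetAlgebra m
  exact h hF

lemma sigmaCoord_add_pderiv_mem {m : ℕ} (τ : Fin (m + 3) → Fin n) :
    (fun p : Nondeg n => sigmaCoord p.1.1.1 p.1.2 τ + pderiv p.1.1.1 τ p.1.2) ∈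
      jetAlgebra n (m + 2) := by
  obtain ⟨F, h1, h2, -⟩ := exists_sigmaCoord_add_pderiv τ
  convert restrictDiag_mem h1 using 1
  ext p
  rw [h2 _ _ p.2]
  ring

lemma sigmaCoord_mem_jetAlgebra {m : ℕ} (τ : Fin (m + 2) → Fin n) :
    (fun p : Nondeg n => sigmaCoord p.1.1.1 p.1.2 τ) ∈ jetAlgebra n (m + 2) := by
  cases m with
  | zero =>
    convert pderiv_mem_jetAlgebra τ (by norm_num) le_rfl using 1
    ext p
    exact sigmaCoord_two _ _ p.2 τ
  | succ m =>
    convert Subalgebra.sub_mem _ (jetAlgebra_mono (Nat.le_succ _) (sigmaCoord_add_pderiv_mem τ))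
      (pderiv_mem_jetAlgebra τ (by omega) le_rfl) using 1
    ext p
    simp

/-- The triangular system is inverted by strong induction on the order: σ_k plus the k-th derivative
has lower order for k ≥ 3. Commuting partial derivatives reduces to weakly increasing indices. -/
lemma pderiv_mem_sigmaAlgebra {k : ℕ} (hk : 1 ≤ k) (τ : Fin k → Fin n) :
    (fun p => pderiv p.1.1.1 τ p.1.2) ∈ sigmaAlgebra n k := by
  induction k using Nat.strong_induction_on with
  | _ k ih =>
    have hsort : (fun p : Nondeg n => pderiv p.1.1.1 τ p.1.2) =
        fun p => pderiv p.1.1.1 (τ ∘ Tuple.sort τ) p.1.2 := by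
      ext p
      exact (pderiv_comp_perm p.1.1.2 τ _ _).symm
    match k, hk, τ, hsort, ih with
    | 1, _, τ, _, _ =>
      have hτ : τ = ![τ 0] := by ext r; fin_cases r; rfl
      refine Algebra.subset_adjoin (Or.inl (Or.inl ⟨τ 0, ?_⟩))
      ext p
      exact congrArg (fun t => pderiv p.1.1.1 t p.1.2) hτ
    | 2, _, τ, hsort, _ =>
      rw [hsort]
      refine Algebra.subset_adjoin (Or.inl (Or.inr
        ⟨⟨0, τ ∘ Tuple.sort τ, Tuple.monotone_sort τ⟩, le_rfl, ?_⟩))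
      ext p
      exact (sigmaCoord_two _ _ p.2 _).symm
    | m + 3, _, τ, hsort, ih =>
      rw [hsort]
      have hle : jetAlgebra n (m + 2) ≤ sigmaAlgebra n (m + 3) := by
        refine Algebra.adjoin_le ?_
        rintro F (⟨k, τ, h1, h2, rfl⟩ | rfl)
        · exact sigmaAlgebra_mono (by omega) (ih k (by omega) h1 τ)
        · exact Algebra.subset_adjoin (Or.inr rfl)
      have hs : (fun p : Nondeg n => sigmaCoord p.1.1.1 p.1.2 (τ ∘ Tuple.sort τ)) ∈
          sigmaAlgebra n (m + 3) :=
        Algebra.subset_adjoin (Or.inl (Or.inr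
          ⟨⟨m + 1, τ ∘ Tuple.sort τ, Tuple.monotone_sort τ⟩, le_rfl, rfl⟩))
      convert Subalgebra.sub_mem _ (hle (sigmaCoord_add_pderiv_mem (τ ∘ Tuple.sort τ))) hs using 1
      ext p
      simp

end

/-! ### Invariance under affine transformations -/

section Aff

variable {n : ℕ}

lemma Aff.symm_apply_eq (g : Aff n) (x y : Space n) :
    g.symm y = g.linear.symm (y - g x) + x := by
  apply g.injective
  rw [g.apply_symm_apply, ← vadd_eq_add, g.map_vadd]
  simp

/-- The linear part of `g⁻¹`. -/
noncomputable def linInv (g : Aff n) : Space n →L[ℝ] Space n :=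
  LinearMap.toContinuousLinearMap g.linear.symm.toLinearMap

/-- Centred at `g x`, the map g⁻¹ is a linear map between two translations, and the chain rule for
iterated derivatives applies to each factor. -/
lemma comp_symm_eq (f : Space n → ℝ) (g : Aff n) (x : Space n) :
    f ∘ g.symm = fun y => ((fun z => f (z + x)) ∘ linInv g) (y - g x) := by
  ext y
  simp [Aff.symm_apply_eq g x y, linInv]

lemma contDiff_comp_symm {f : Space n → ℝ} (hf : ContDiff ℝ ∞ f) (g : Aff n) :
    ContDiff ℝ ∞ (f ∘ g.symm) := by
  rw [comp_symm_eq f g 0]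
  fun_prop

lemma iteratedFDeriv_comp_symm {f : Space n → ℝ} (hf : ContDiff ℝ ∞ f) (g : Aff n) (k : ℕ)
    (x : Space n) (w : Fin k → Space n) :
    iteratedFDeriv ℝ k (f ∘ g.symm) (g x) w =
      iteratedFDeriv ℝ k f x (fun r => g.linear.symm (w r)) := by
  rw [comp_symm_eq f g x, iteratedFDeriv_comp_sub,
    ContinuousLinearMap.iteratedFDeriv_comp_right (n := ∞) _ (by fun_prop) _
      (by exact_mod_cast le_top), sub_self, map_zero, iteratedFDeriv_comp_add_right, zero_add]
  rfl

lemma iteratedFDeriv_expand (f : Space n → ℝ) (k : ℕ) (x : Space n) (w : Fin k → Space n) :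
    iteratedFDeriv ℝ k f x w = ∑ ρ : Fin k → Fin n, (∏ r, w r (ρ r)) * pderiv f ρ x := by
  have hw : w = fun r => ∑ i, w r i • (e i : Space n) := by
    ext r j
    simp [e, Finset.sum_apply, Pi.single_apply]
  conv_lhs => rw [hw]
  rw [ContinuousMultilinearMap.map_sum]
  refine Finset.sum_congr rfl fun ρ _ => ?_
  rw [ContinuousMultilinearMap.map_smul_univ]
  rfl

/-- The matrix of the linear part of `g`. -/
noncomputable def linMat (g : Aff n) : Matrix (Fin n) (Fin n) ℝ :=
  LinearMap.toMatrix' g.linear.toLinearMap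

/-- The matrix of the linear part of `g⁻¹`. -/
noncomputable def linMatInv (g : Aff n) : Matrix (Fin n) (Fin n) ℝ :=
  LinearMap.toMatrix' g.linear.symm.toLinearMap

lemma linMat_mulVec (g : Aff n) (w : Space n) : (linMat g).mulVec w = g.linear w := by
  rw [linMat, LinearMap.toMatrix'_mulVec]
  rfl

lemma linMatInv_mulVec (g : Aff n) (w : Space n) :
    (linMatInv g).mulVec w = g.linear.symm w := by
  rw [linMatInv, LinearMap.toMatrix'_mulVec]
  rfl

lemma linMatInv_mul_linMat (g : Aff n) : linMatInv g * linMat g = 1 := by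
  rw [linMat, linMatInv, ← LinearMap.toMatrix'_comp]
  simp

lemma linMat_mul_linMatInv (g : Aff n) : linMat g * linMatInv g = 1 := by
  rw [linMat, linMatInv, ← LinearMap.toMatrix'_comp]
  simp

lemma linear_symm_e (g : Aff n) (i a : Fin n) : g.linear.symm (e i) a = linMatInv g a i := by
  rw [← linMatInv_mulVec, mulVec_e]

lemma pderiv_comp_symm {k : ℕ} {f : Space n → ℝ} (hf : ContDiff ℝ ∞ f) (g : Aff n)
    (τ : Fin k → Fin n) (x : Space n) :
    pderiv (f ∘ g.symm) τ (g x) = iteratedFDeriv ℝ k f x (fun r => g.linear.symm (e (τ r))) :=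
  iteratedFDeriv_comp_symm hf g k x _

lemma momentum_comp_symm {f : Space n → ℝ} (hf : ContDiff ℝ ∞ f) (g : Aff n) (x : Space n) :
    momentum (f ∘ g.symm) (g x) = (linMatInv g).transpose.mulVec (momentum f x) := by
  ext i
  rw [momentum_eq_pderiv, pderiv_comp_symm hf, iteratedFDeriv_expand, sum_fin_succ_pi]
  refine Finset.sum_congr rfl fun a _ => ?_
  have : ∀ ρ : Fin 0 → Fin n, (Fin.cons a ρ : Fin 1 → Fin n) = ![a] := fun ρ => by
    ext r; fin_cases r; rfl
  simp [linear_symm_e, momentum_eq_pderiv, this]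

lemma hess_comp_symm {f : Space n → ℝ} (hf : ContDiff ℝ ∞ f) (g : Aff n) (x : Space n) :
    hess (f ∘ g.symm) (g x) = (linMatInv g).transpose * hess f x * linMatInv g := by
  ext i j
  rw [hess_eq_pderiv, pderiv_comp_symm hf, iteratedFDeriv_expand, sum_fin_succ_pi,
    Matrix.mul_assoc, Matrix.mul_apply]
  refine Finset.sum_congr rfl fun a _ => ?_
  rw [Matrix.mul_apply, sum_fin_succ_pi, Finset.mul_sum]
  refine Finset.sum_congr rfl fun b _ => ?_
  have : ∀ ρ : Fin 0 → Fin n,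
      (Fin.cons a (Fin.cons b ρ : Fin 1 → Fin n) : Fin 2 → Fin n) = ![a, b] := fun ρ => by
    ext r; fin_cases r <;> rfl
  simp [linear_symm_e, hess_eq_pderiv, this]
  ring

lemma hess_inv_comp_symm {f : Space n → ℝ} (hf : ContDiff ℝ ∞ f) (g : Aff n) (x : Space n) :
    (hess (f ∘ g.symm) (g x))⁻¹ = linMat g * (hess f x)⁻¹ * (linMat g).transpose := by
  have h : (linMatInv g)⁻¹ = linMat g := Matrix.inv_eq_right_inv (linMatInv_mul_linMat g)
  rw [hess_comp_symm hf, Matrix.mul_inv_rev, Matrix.mul_inv_rev, ← Matrix.transpose_nonsing_inv, h,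
    Matrix.mul_assoc]

lemma hess_det_comp_symm {f : Space n → ℝ} (hf : ContDiff ℝ ∞ f) (g : Aff n) (x : Space n) :
    (hess (f ∘ g.symm) (g x)).det ≠ 0 ↔ (hess f x).det ≠ 0 := by
  have h : (linMatInv g).det ≠ 0 := fun h0 => by
    have := congrArg Matrix.det (linMatInv_mul_linMat g)
    rw [Matrix.det_mul, h0] at this
    simp at this
  rw [hess_comp_symm hf, Matrix.det_mul, Matrix.det_mul, Matrix.det_transpose]
  simp [h]

lemma fderiv_eq_fderiv_comp (g : Aff n) (F : Space n → ℝ) (x w : Space n) :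
    fderiv ℝ F (g x) w = fderiv ℝ (F ∘ g) x (g.linear.symm w) := by
  let L : Space n ≃L[ℝ] Space n := g.linear.toContinuousLinearEquiv
  have h : F ∘ g = fun y => ((fun z => F (z + g 0)) ∘ L) y := by
    ext y
    have : g y = g.linear y + g 0 := by
      have := g.map_vadd 0 y
      simpa using this
    simp [L, this]
  have h0 : g x = L x + g 0 := by
    have := g.map_vadd 0 x
    simpa [L] using this
  rw [h]
  change _ = fderiv ℝ ((fun z => F (z + g 0)) ∘ L) x (g.linear.symm w)
  rw [L.comp_right_fderiv, fderiv_comp_add_right, ← h0]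
  simp [L]

lemma fderiv_expand (F : Space n → ℝ) (x w : Space n) :
    fderiv ℝ F x w = ∑ a, w a * fderiv ℝ F x (e a) := by
  have hw : w = ∑ i, w i • (e i : Space n) := by
    ext j
    simp [e, Finset.sum_apply, Pi.single_apply]
  conv_lhs => rw [hw]
  simp

/-- The momenta transform as covectors, hence the ∂/∂λ_j transform as the components of a vector. -/
lemma dLambda_comp_symm {f : Space n → ℝ} (hf : ContDiff ℝ ∞ f) (g : Aff n) (j : Fin n)
    (F : Space n → ℝ) (x : Space n) :
    dLambda (f ∘ g.symm) j F (g x) = ∑ m, linMat g j m * dLambda f m (F ∘ g) x := by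
  have hM : linMatInv g * (linMat g * (hess f x)⁻¹ * (linMat g).transpose) =
      (hess f x)⁻¹ * (linMat g).transpose := by
    rw [← Matrix.mul_assoc, ← Matrix.mul_assoc, linMatInv_mul_linMat, Matrix.one_mul]
  simp only [dLambda, hess_inv_comp_symm hf, fderiv_eq_fderiv_comp]
  have h1 : ∀ i, fderiv ℝ (F ∘ g) x (g.linear.symm (e i)) =
      ∑ a, linMatInv g a i * fderiv ℝ (F ∘ g) x (e a) := fun i => by
    rw [fderiv_expand]
    simp only [linear_symm_e]
  simp only [h1, Finset.mul_sum]
  rw [Finset.sum_comm, Finset.sum_comm (f := fun m i => linMat g j m * _)]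
  refine Finset.sum_congr rfl fun a _ => ?_
  have h2 := congrFun (congrFun hM a) j
  rw [Matrix.mul_apply, Matrix.mul_apply] at h2
  have h3 := congrArg (fun t => t * fderiv ℝ (F ∘ g) x (e a)) h2
  simp only [Finset.sum_mul] at h3
  calc _ = _ := Finset.sum_congr rfl fun i _ => by ring
    _ = _ := h3
    _ = _ := Finset.sum_congr rfl fun i _ => by rw [Matrix.transpose_apply]; ring

/-- Both f and the pairing ⟨λ, x - c⟩ are unchanged when x and c move together. -/
lemma partitionFunction_comp_symm {f : Space n → ℝ} (hf : ContDiff ℝ ∞ f) (g : Aff n)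
    (c x : Space n) :
    partitionFunction (f ∘ g.symm) (g c) (g x) = partitionFunction f c x := by
  have h : ∀ i, g x i - g c i = (linMat g).mulVec (x - c) i := fun i => by
    rw [linMat_mulVec]
    exact (congrFun (g.toAffineMap.linearMap_vsub x c) i).symm
  have h1 : (linMatInv g).transpose.mulVec (momentum f x) ⬝ᵥ (linMat g).mulVec (x - c) =
      momentum f x ⬝ᵥ (x - c) := by
    rw [Matrix.mulVec_transpose, ← Matrix.dotProduct_mulVec, Matrix.mulVec_mulVec,
      linMatInv_mul_linMat, Matrix.one_mulVec]
  rw [partitionFunction_eq, partitionFunction_eq, momentum_comp_symm hf]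
  simp only [h]
  simp only [dotProduct, Pi.sub_apply] at h1
  rw [h1]
  simp

lemma dLambda_congr {f F G : Space n → ℝ} {x : Space n} (h : F =ᶠ[nhds x] G) (j : Fin n) :
    dLambda f j F x = dLambda f j G x := by
  simp only [dLambda, h.fderiv_eq]

lemma dLambda_sum {ι : Type*} (s : Finset ι) (f : Space n → ℝ) (c : ι → ℝ) (F : ι → Space n → ℝ)
    (x : Space n) (h : ∀ i ∈ s, DifferentiableAt ℝ (F i) x) (j : Fin n) :
    dLambda f j (fun y => ∑ i ∈ s, c i * F i y) x = ∑ i ∈ s, c i * dLambda f j (F i) x := by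
  simp only [dLambda, Finset.mul_sum]
  rw [Finset.sum_comm]
  refine Finset.sum_congr rfl fun a _ => ?_
  rw [fderiv_fun_sum fun i hi => (h i hi).const_mul (c i), sum_apply, Finset.mul_sum]
  refine Finset.sum_congr rfl fun i hi => ?_
  rw [fderiv_const_mul (h i hi)]
  simp
  ring

lemma differentiableAt_foldr_dLambda {k : ℕ} (f : SmoothFun n) (c x : Space n)
    (hx : (hess f.1 x).det ≠ 0) (τ : Fin k → Fin n) :
    DifferentiableAt ℝ ((List.ofFn τ).foldr (dLambda f.1) (partitionFunction f.1 c)) x := by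
  obtain ⟨F, h1, h2⟩ := exists_isMomentExpr τ
  obtain ⟨F', -, h4⟩ := exists_hasPartials (by omega) h1
  have h : (List.ofFn τ).foldr (dLambda f.1) (partitionFunction f.1 c) =ᶠ[nhds x]
      fun y => F (f, c, y) * partitionFunction f.1 c y := by
    filter_upwards [eventually_hess_det_ne f.2 hx] with y hy
    exact h2 f c y hy
  exact ((h4 f c x hx).1.mul (hasFDerivAt_partitionFunction f.2 c x).1).congr_of_eventuallyEq h

/-- In the induction `c` is fixed while `x` varies, since the identity must hold near `x` to be
differentiated once more. -/
lemma foldr_dLambda_comp_symm {k : ℕ} (f : SmoothFun n) (g : Aff n) (c x : Space n)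
    (hx : (hess f.1 x).det ≠ 0) (τ : Fin k → Fin n) :
    (List.ofFn τ).foldr (dLambda (f.1 ∘ g.symm)) (partitionFunction (f.1 ∘ g.symm) (g c)) (g x) =
      ∑ ρ : Fin k → Fin n, (∏ r, linMat g (τ r) (ρ r)) *
        (List.ofFn ρ).foldr (dLambda f.1) (partitionFunction f.1 c) x := by
  induction k generalizing x with
  | zero => simp [partitionFunction_comp_symm f.2]
  | succ k ih =>
    rw [List.ofFn_succ, List.foldr_cons, dLambda_comp_symm f.2, sum_fin_succ_pi]
    refine Finset.sum_congr rfl fun m _ => ?_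
    have h : ((List.ofFn fun i => τ i.succ).foldr (dLambda (f.1 ∘ g.symm))
        (partitionFunction (f.1 ∘ g.symm) (g c))) ∘ g =ᶠ[nhds x] fun y =>
        ∑ ρ : Fin k → Fin n, (∏ r : Fin k, linMat g (τ r.succ) (ρ r)) *
          (List.ofFn ρ).foldr (dLambda f.1) (partitionFunction f.1 c) y := by
      filter_upwards [eventually_hess_det_ne f.2 hx] with y hy
      exact ih y hy _
    rw [dLambda_congr h, dLambda_sum _ _ _ _ _
      (fun ρ _ => differentiableAt_foldr_dLambda f c x hx ρ), Finset.mul_sum]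
    refine Finset.sum_congr rfl fun ρ _ => ?_
    rw [List.ofFn_succ, Fin.prod_univ_succ]
    simp [mul_assoc]

lemma centralMoment_comp_symm {k : ℕ} (f : SmoothFun n) (g : Aff n) (x : Space n)
    (hx : (hess f.1 x).det ≠ 0) (τ : Fin k → Fin n) :
    centralMoment (f.1 ∘ g.symm) τ (g x) =
      ∑ ρ : Fin k → Fin n, (∏ r, linMat g (τ r) (ρ r)) * centralMoment f.1 ρ x := by
  have h1 : mean (f.1 ∘ g.symm) (g x) = g x :=
    mean_eq ⟨_, contDiff_comp_symm f.2 g⟩ (g x) ((hess_det_comp_symm f.2 g x).2 hx)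
  simp only [centralMoment, h1, mean_eq f x hx, moment]
  rw [foldr_dLambda_comp_symm f g x x hx, partitionFunction_comp_symm f.2, Finset.sum_div]
  simp only [mul_div_assoc]

lemma sigma_comp_symm {k : ℕ} (f : SmoothFun n) (g : Aff n) (x : Space n)
    (hx : (hess f.1 x).det ≠ 0) (w : Fin k → Space n) :
    sigma (f.1 ∘ g.symm) (g x) (fun r => g.linear (w r)) = sigma f.1 x w := by
  have h1 : ∀ r, (hess (f.1 ∘ g.symm) (g x)).mulVec (g.linear (w r)) =
      (linMatInv g).transpose.mulVec ((hess f.1 x).mulVec (w r)) := fun r => by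
    rw [← linMat_mulVec, hess_comp_symm f.2, Matrix.mulVec_mulVec, Matrix.mul_assoc,
      linMatInv_mul_linMat, Matrix.mul_one, Matrix.mulVec_mulVec]
  have h2 : ∀ v : Space n, ∀ i, ∑ t, linMat g t i * (linMatInv g).transpose.mulVec v t = v i :=
    fun v i => by
      have h3 := congrFun (Matrix.mulVec_mulVec v (linMat g).transpose (linMatInv g).transpose) i
      rw [← Matrix.transpose_mul, linMatInv_mul_linMat, Matrix.transpose_one,
        Matrix.one_mulVec] at h3
      exact h3
  simp only [sigma, h1, centralMoment_comp_symm f g x hx, Finset.sum_mul]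
  rw [Finset.sum_comm]
  refine Finset.sum_congr rfl fun ρ _ => ?_
  have h4 : ∏ r, (hess f.1 x).mulVec (w r) (ρ r) = ∏ r, ∑ t, linMat g t (ρ r) *
      (linMatInv g).transpose.mulVec ((hess f.1 x).mulVec (w r)) t := by
    simp only [h2]
  rw [h4, Fintype.prod_sum, Finset.mul_sum]
  refine Finset.sum_congr rfl fun τ _ => ?_
  rw [Finset.prod_mul_distrib]
  ring

/-! ### The frame -/

/-- The matrix of the bilinear form `σ₃(v₁, ⬝, ⬝)`. -/
noncomputable def sigmaThree (f : Space n → ℝ) (x : Space n) : Matrix (Fin n) (Fin n) ℝ :=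
  Matrix.of fun i j => sigma f x ![vOne f x, e i, e j]

lemma sigma_vOne_eq_sum (f : Space n → ℝ) (x w w' : Space n) : sigma f x ![vOne f x, w, w'] =
    ∑ b, ∑ d, (∑ a, sigmaCoord f x ![a, b, d] * vOne f x a) * (w b * w' d) := by
  rw [sigma_expand, sum_fin_succ_pi]
  simp only [Finset.sum_mul]
  rw [Finset.sum_comm' (t' := Finset.univ) (s' := fun _ => Finset.univ) (by simp)]
  rw [sum_fin_succ_pi]
  refine Finset.sum_congr rfl fun b _ => ?_
  rw [sum_fin_succ_pi]
  refine Finset.sum_congr rfl fun d _ => ?_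
  rw [Fintype.sum_unique]
  refine Finset.sum_congr rfl fun a _ => ?_
  have : (Fin.cons a (Fin.cons b (Fin.cons d default : Fin 1 → Fin n) : Fin 2 → Fin n) :
      Fin 3 → Fin n) = ![a, b, d] := by
    ext r; fin_cases r <;> rfl
  rw [this]
  simp [Fin.prod_univ_three]
  ring

lemma sigmaThree_apply (f : Space n → ℝ) (x : Space n) (b d : Fin n) :
    sigmaThree f x b d = ∑ a, sigmaCoord f x ![a, b, d] * vOne f x a := by
  rw [sigmaThree, Matrix.of_apply, sigma_vOne_eq_sum]
  simp [e, Pi.single_apply]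

lemma sigma_vOne_eq (f : Space n → ℝ) (x w w' : Space n) :
    sigma f x ![vOne f x, w, w'] = w ⬝ᵥ (sigmaThree f x).mulVec w' := by
  rw [sigma_vOne_eq_sum]
  simp only [← sigmaThree_apply, dotProduct, Matrix.mulVec, Finset.mul_sum]
  exact Finset.sum_congr rfl fun b _ => Finset.sum_congr rfl fun d _ => by ring

lemma vOne_eq (f : SmoothFun n) (x : Space n) (hx : (hess f.1 x).det ≠ 0) :
    vOne f.1 x = (hess f.1 x)⁻¹.mulVec (momentum f.1 x) := by
  rw [vOne, sigmaTwo_eq f x hx]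

lemma endoA_eq (f : SmoothFun n) (x : Space n) (hx : (hess f.1 x).det ≠ 0) :
    endoA f.1 x = (hess f.1 x)⁻¹ * sigmaThree f.1 x := by
  rw [endoA, sigmaTwo_eq f x hx, sigmaThree]

lemma vOne_comp_symm (f : SmoothFun n) (g : Aff n) (x : Space n) (hx : (hess f.1 x).det ≠ 0) :
    vOne (f.1 ∘ g.symm) (g x) = g.linear (vOne f.1 x) := by
  rw [vOne_eq f x hx, vOne_eq ⟨_, contDiff_comp_symm f.2 g⟩ (g x)
    ((hess_det_comp_symm f.2 g x).2 hx), ← linMat_mulVec, hess_inv_comp_symm f.2,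
    momentum_comp_symm f.2, Matrix.mulVec_mulVec, Matrix.mul_assoc, ← Matrix.transpose_mul,
    linMatInv_mul_linMat, Matrix.transpose_one, Matrix.mul_one, Matrix.mulVec_mulVec]

lemma sigmaThree_comp_symm (f : SmoothFun n) (g : Aff n) (x : Space n)
    (hx : (hess f.1 x).det ≠ 0) : sigmaThree (f.1 ∘ g.symm) (g x) =
      (linMatInv g).transpose * sigmaThree f.1 x * linMatInv g := by
  ext i j
  have h := sigma_comp_symm f g x hx ![vOne f.1 x, g.linear.symm (e i), g.linear.symm (e j)]
  have h1 : (fun r => g.linear ((![vOne f.1 x, g.linear.symm (e i), g.linear.symm (e j)] :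
      Fin 3 → Space n) r)) = ![vOne (f.1 ∘ g.symm) (g x), e i, e j] := by
    ext r : 1
    fin_cases r
    · exact (vOne_comp_symm f g x hx).symm
    · simp
    · simp
  have h2 : ((linMatInv g).transpose * sigmaThree f.1 x * linMatInv g) i j =
      (linMatInv g).transpose.mulVec
        ((sigmaThree f.1 x).mulVec ((linMatInv g).mulVec (e j))) i := by
    rw [Matrix.mulVec_mulVec, Matrix.mulVec_mulVec, mulVec_e, Matrix.mul_assoc]
  rw [h1] at h
  rw [sigmaThree, Matrix.of_apply, h, sigma_vOne_eq, ← linMatInv_mulVec, ← linMatInv_mulVec, h2]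
  set v := (sigmaThree f.1 x).mulVec ((linMatInv g).mulVec (e j))
  change ∑ a, (linMatInv g).mulVec (e i) a * v a = ∑ a, linMatInv g a i * v a
  simp only [mulVec_e]

lemma endoA_comp_symm (f : SmoothFun n) (g : Aff n) (x : Space n) (hx : (hess f.1 x).det ≠ 0) :
    endoA (f.1 ∘ g.symm) (g x) = linMat g * endoA f.1 x * linMatInv g := by
  rw [endoA_eq f x hx, endoA_eq ⟨_, contDiff_comp_symm f.2 g⟩ (g x)
    ((hess_det_comp_symm f.2 g x).2 hx), hess_inv_comp_symm f.2, sigmaThree_comp_symm f g x hx]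
  have : (linMat g).transpose * (linMatInv g).transpose = 1 := by
    rw [← Matrix.transpose_mul, linMatInv_mul_linMat, Matrix.transpose_one]
  calc _ = linMat g * (hess f.1 x)⁻¹ * ((linMat g).transpose * (linMatInv g).transpose) *
        sigmaThree f.1 x * linMatInv g := by simp only [Matrix.mul_assoc]
    _ = _ := by rw [this]; simp only [Matrix.mul_assoc, Matrix.mul_one]

lemma frame_comp_symm (f : SmoothFun n) (g : Aff n) (x : Space n) (hx : (hess f.1 x).det ≠ 0)
    (i : Fin n) : frame (f.1 ∘ g.symm) (g x) i = g.linear (frame f.1 x i) := by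
  have h : ∀ m : ℕ, (linMat g * endoA f.1 x * linMatInv g) ^ m =
      linMat g * endoA f.1 x ^ m * linMatInv g := fun m => by
    induction m with
    | zero => simp [linMat_mul_linMatInv]
    | succ m ih =>
      calc _ = linMat g * endoA f.1 x ^ m * (linMatInv g * linMat g) * endoA f.1 x *
            linMatInv g := by rw [pow_succ, ih]; simp only [Matrix.mul_assoc]
        _ = _ := by rw [linMatInv_mul_linMat, Matrix.mul_one, Matrix.mul_assoc (linMat g), ← pow_succ]
  rw [frame, frame, endoA_comp_symm f g x hx, h, vOne_comp_symm f g x hx, ← linMat_mulVec,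
    Matrix.mulVec_mulVec, Matrix.mul_assoc, linMatInv_mul_linMat, Matrix.mul_one,
    ← Matrix.mulVec_mulVec, linMat_mulVec]

lemma generator_comp_symm (f : SmoothFun n) (g : Aff n) (x : Space n) (hx : (hess f.1 x).det ≠ 0)
    (I : GenIndex n) : generator (f.1 ∘ g.symm) (g x) I = generator f.1 x I := by
  simp only [generator, frame_comp_symm f g x hx, sigma_comp_symm f g x hx]

lemma isRegularAt_comp_symm (f : SmoothFun n) (g : Aff n) (x : Space n)
    (h : IsRegularAt f.1 x) : IsRegularAt (f.1 ∘ g.symm) (g x) := by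
  refine ⟨(hess_det_comp_symm f.2 g x).2 h.1, ?_⟩
  have h1 : frame (f.1 ∘ g.symm) (g x) = g.linear.toLinearMap ∘ frame f.1 x := by
    ext1 i
    exact frame_comp_symm f g x h.1 i
  rw [h1]
  exact h.2.map' _ (LinearMap.ker_eq_bot.2 g.linear.injective)

lemma evalGen_comp_symm (P : MvPolynomial (GenIndex n) (ℝ → ℝ)) (f : SmoothFun n) (g : Aff n)
    (x : Space n) (hx : (hess f.1 x).det ≠ 0) :
    evalGen P (f.1 ∘ g.symm) (g x) = evalGen P f.1 x := by
  have h : generator (f.1 ∘ g.symm) (g x) = generator f.1 x :=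
    funext (generator_comp_symm f g x hx)
  simp [evalGen, h]

end Aff

/-! ### Clearing denominators -/

/-- Applied with `d` the Hessian determinant, for jets, and with `d` the Gram determinant, for frame
coefficients. -/
lemma exists_mul_pow_mem {B : Type*} [CommRing B] [Algebra ℝ B] (s : Set B) {d d' F : B}
    (hd : d ∈ Algebra.adjoin ℝ s) (h : d * d' = 1) (hF : F ∈ Algebra.adjoin ℝ (s ∪ {d'})) :
    ∃ N, F * d ^ N ∈ Algebra.adjoin ℝ s := by
  induction hF using Algebra.adjoin_induction with
  | mem F hF =>
    rcases hF with hF | rfl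
    · exact ⟨0, by simpa using Algebra.subset_adjoin hF⟩
    · exact ⟨1, by rw [pow_one, mul_comm, h]; exact Subalgebra.one_mem _⟩
  | algebraMap r => exact ⟨0, by simp⟩
  | add F G _ _ h1 h2 =>
    obtain ⟨N, h1⟩ := h1
    obtain ⟨M, h2⟩ := h2
    refine ⟨N + M, ?_⟩
    have : (F + G) * d ^ (N + M) = F * d ^ N * d ^ M + G * d ^ M * d ^ N := by ring
    rw [this]
    exact Subalgebra.add_mem _ (Subalgebra.mul_mem _ h1 (Subalgebra.pow_mem _ hd _))
      (Subalgebra.mul_mem _ h2 (Subalgebra.pow_mem _ hd _))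
  | mul F G _ _ h1 h2 =>
    obtain ⟨N, h1⟩ := h1
    obtain ⟨M, h2⟩ := h2
    refine ⟨N + M, ?_⟩
    have : F * G * d ^ (N + M) = F * d ^ N * (G * d ^ M) := by ring
    rw [this]
    exact Subalgebra.mul_mem _ h1 h2

/-- The Hessian determinant as a polynomial in the fibre coordinates. -/
noncomputable def hessPoly (n : ℕ) {m : ℕ} (hm : 2 ≤ m) : MvPolynomial (FiberIndex n m) ℝ :=
  (Matrix.of fun i j : Fin n => (MvPolynomial.X ⟨⟨1, hm⟩, ![i, j]⟩ :
    MvPolynomial (FiberIndex n m) ℝ)).det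

lemma eval_hessPoly {n m : ℕ} (hm : 2 ≤ m) (f : Space n → ℝ) (x : Space n) :
    MvPolynomial.eval (jet m f x).fiber (hessPoly n hm) = (hess f x).det := by
  rw [hessPoly, RingHom.map_det]
  congr 1
  ext i j
  rw [hess_eq_pderiv]
  simp [jet, pderiv]

lemma hessPoly_mem_supported {n m : ℕ} (hm : 2 ≤ m) :
    hessPoly n hm ∈ MvPolynomial.supported ℝ {τ : FiberIndex n m | τ.1.1 + 1 ≤ 2} := by
  rw [hessPoly, Matrix.det_apply]
  refine Subalgebra.sum_mem _ fun s _ => ?_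
  rw [Units.smul_def]
  refine Subalgebra.zsmul_mem _ (Subalgebra.prod_mem _ fun i _ => ?_) _
  rw [Matrix.of_apply, MvPolynomial.supported_eq_adjoin_X]
  exact Algebra.subset_adjoin ⟨_, by simp, rfl⟩

/-- A function in the jet algebra is a polynomial in the fibre coordinates divided by a power of
the Hessian determinant. -/
lemma exists_poly_of_mem_jetAlgebra {n m : ℕ} (hm : 2 ≤ m) {F : Nondeg n → ℝ}
    (hF : F ∈ jetAlgebra n m) : ∃ (N : ℕ) (P : MvPolynomial (FiberIndex n m) ℝ),
      ∀ p : Nondeg n, F p * (hess p.1.1.1 p.1.2).det ^ N =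
        MvPolynomial.eval (jet m p.1.1.1 p.1.2).fiber P := by
  have hd : (fun p : Nondeg n => (hess p.1.1.1 p.1.2).det) ∈
      Algebra.adjoin ℝ {F | ∃ (k : ℕ) (τ : Fin k → Fin n), 1 ≤ k ∧ k ≤ m ∧
        F = fun p : Nondeg n => pderiv p.1.1.1 τ p.1.2} := by
    refine det_mem_subalgebra _ _ fun i j => ?_
    simp only [hess_eq_pderiv]
    exact Algebra.subset_adjoin ⟨2, _, by norm_num, hm, rfl⟩
  obtain ⟨N, hN⟩ := exists_mul_pow_mem _ hd (d' := detInv)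
    (by ext p; exact mul_inv_cancel₀ p.2) hF
  suffices h : ∀ G ∈ Algebra.adjoin ℝ {F | ∃ (k : ℕ) (τ : Fin k → Fin n), 1 ≤ k ∧ k ≤ m ∧
        F = fun p : Nondeg n => pderiv p.1.1.1 τ p.1.2},
      ∃ P : MvPolynomial (FiberIndex n m) ℝ, ∀ p : Nondeg n, G p =
        MvPolynomial.eval (jet m p.1.1.1 p.1.2).fiber P by
    obtain ⟨P, hP⟩ := h _ hN
    exact ⟨N, P, hP⟩
  intro G hG
  induction hG using Algebra.adjoin_induction with
  | mem F hF =>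
    obtain ⟨k, τ, h1, h2, rfl⟩ := hF
    obtain ⟨k, rfl⟩ := Nat.exists_eq_add_of_le' h1
    exact ⟨MvPolynomial.X ⟨⟨k, h2⟩, τ⟩, fun p => by simp [jet, pderiv]⟩
  | algebraMap r => exact ⟨MvPolynomial.C r, fun p => by simp⟩
  | add F G _ _ h1 h2 =>
    obtain ⟨P, h1⟩ := h1
    obtain ⟨Q, h2⟩ := h2
    exact ⟨P + Q, fun p => by simp [h1, h2]⟩
  | mul F G _ _ h1 h2 =>
    obtain ⟨P, h1⟩ := h1
    obtain ⟨Q, h2⟩ := h2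
    exact ⟨P * Q, fun p => by simp [h1, h2]⟩

/-! ### The frame coefficients as functions of jets -/

section

variable {n : ℕ}

lemma hess_inv_mem_jetAlgebra {m : ℕ} (hm : 2 ≤ m) (i j : Fin n) :
    (fun p : Nondeg n => (hess p.1.1.1 p.1.2)⁻¹ i j) ∈ jetAlgebra n m :=
  restrictDiag_mem (hess_inv_mem_jetExpr hm i j)

lemma vOne_mem_jetAlgebra (i : Fin n) :
    (fun p : Nondeg n => vOne p.1.1.1 p.1.2 i) ∈ jetAlgebra n 3 := by
  have h : (fun p : Nondeg n => vOne p.1.1.1 p.1.2 i) =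
      ∑ j, (fun p : Nondeg n => (hess p.1.1.1 p.1.2)⁻¹ i j) *
        fun p : Nondeg n => pderiv p.1.1.1 ![j] p.1.2 := by
    ext p
    rw [vOne_eq _ _ p.2]
    simp [Matrix.mulVec, dotProduct, momentum_eq_pderiv]
  rw [h]
  exact Subalgebra.sum_mem _ fun j _ => Subalgebra.mul_mem _
    (hess_inv_mem_jetAlgebra (by norm_num) i j)
    (pderiv_mem_jetAlgebra _ (by norm_num) (by norm_num))

lemma endoA_mem_jetAlgebra (i j : Fin n) :
    (fun p : Nondeg n => endoA p.1.1.1 p.1.2 i j) ∈ jetAlgebra n 3 := by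
  have h : (fun p : Nondeg n => endoA p.1.1.1 p.1.2 i j) =
      ∑ b, (fun p : Nondeg n => (hess p.1.1.1 p.1.2)⁻¹ i b) *
        ∑ a, (fun p : Nondeg n => sigmaCoord p.1.1.1 p.1.2 ![a, b, j]) *
          fun p : Nondeg n => vOne p.1.1.1 p.1.2 a := by
    ext p
    rw [endoA_eq _ _ p.2, Matrix.mul_apply]
    simp [sigmaThree_apply]
  rw [h]
  exact Subalgebra.sum_mem _ fun b _ => Subalgebra.mul_mem _
    (hess_inv_mem_jetAlgebra (by norm_num) i b) (Subalgebra.sum_mem _ fun a _ =>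
      Subalgebra.mul_mem _ (sigmaCoord_mem_jetAlgebra _) (vOne_mem_jetAlgebra a))

lemma frame_mem_jetAlgebra (i a : Fin n) :
    (fun p : Nondeg n => frame p.1.1.1 p.1.2 i a) ∈ jetAlgebra n 3 := by
  have h : ∀ (m : ℕ) (a : Fin n), (fun p : Nondeg n =>
      ((endoA p.1.1.1 p.1.2) ^ m).mulVec (vOne p.1.1.1 p.1.2) a) ∈ jetAlgebra n 3 := by
    intro m
    induction m with
    | zero => simpa using vOne_mem_jetAlgebra
    | succ m ih =>
      intro a
      have h : (fun p : Nondeg n =>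
          ((endoA p.1.1.1 p.1.2) ^ (m + 1)).mulVec (vOne p.1.1.1 p.1.2) a) =
          ∑ b, (fun p : Nondeg n => endoA p.1.1.1 p.1.2 a b) * fun p : Nondeg n =>
            ((endoA p.1.1.1 p.1.2) ^ m).mulVec (vOne p.1.1.1 p.1.2) b := by
        ext p
        rw [pow_succ', ← Matrix.mulVec_mulVec]
        simp [Matrix.mulVec, dotProduct]
      rw [h]
      exact Subalgebra.sum_mem _ fun b _ => Subalgebra.mul_mem _ (endoA_mem_jetAlgebra a b) (ih b)
  exact h i a

/-- The frame involves third derivatives through σ_3, hence the `max` even for σ_2. -/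
lemma generator_mem_jetAlgebra (I : GenIndex n) :
    (fun p : Nondeg n => generator p.1.1.1 p.1.2 I) ∈ jetAlgebra n (max 3 (I.1 + 2)) := by
  have h : (fun p : Nondeg n => generator p.1.1.1 p.1.2 I) =
      ∑ τ : Fin (I.1 + 2) → Fin n, (fun p : Nondeg n => sigmaCoord p.1.1.1 p.1.2 τ) *
        ∏ r, fun p : Nondeg n => frame p.1.1.1 p.1.2 (I.2.1 r) (τ r) := by
    ext p
    rw [generator, sigma_expand]
    simp
  rw [h]
  exact Subalgebra.sum_mem _ fun τ _ => Subalgebra.mul_mem _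
    (jetAlgebra_mono (le_max_right _ _) (sigmaCoord_mem_jetAlgebra τ))
    (Subalgebra.prod_mem _ fun r _ =>
      jetAlgebra_mono (le_max_left _ _) (frame_mem_jetAlgebra _ _))

end

/-! ### A function with a regular jet -/

lemma hasFDerivAt_coord {n : ℕ} {ψ ψ' : ℝ → ℝ} (h : ∀ t, HasDerivAt ψ (ψ' t) t) (x y : Space n)
    (b : Fin n) : HasFDerivAt (fun y : Space n => ψ (y b - x b))
      (ψ' (y b - x b) • ContinuousLinearMap.proj (R := ℝ) (φ := fun _ : Fin n => ℝ) b) y :=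
  (h _).comp_hasFDerivAt y ((hasFDerivAt_apply b y).sub_const (x b))

/-- A polynomial function whose `3`-jet at `x` is regular, with value `u` at `x`. -/
noncomputable def regularFun {n : ℕ} (x : Space n) (u : ℝ) (y : Space n) : ℝ :=
  u + ∑ i : Fin n, ((y i - x i) + (y i - x i) ^ 2 / 2 - (i : ℝ) * (y i - x i) ^ 3 / 6)

section regularFun

variable {n : ℕ} (x : Space n) (u : ℝ)

lemma contDiff_regularFun : ContDiff ℝ ∞ (regularFun x u) := by
  unfold regularFun
  fun_prop

lemma regularFun_self : regularFun x u x = u := by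
  simp [regularFun]

lemma pderiv_regularFun_one (a : Fin n) (y : Space n) : pderiv (regularFun x u) ![a] y =
    1 + (y a - x a) - (a : ℝ) * (y a - x a) ^ 2 / 2 := by
  rw [← momentum_eq_pderiv, momentum]
  have h : HasFDerivAt (regularFun x u) (∑ i : Fin n,
      (1 + (y i - x i) - (i : ℝ) * (y i - x i) ^ 2 / 2) •
        ContinuousLinearMap.proj (R := ℝ) (φ := fun _ : Fin n => ℝ) i) y := by
    refine (HasFDerivAt.fun_sum fun (i : Fin n) _ => hasFDerivAt_coord
      (ψ := fun t => t + t ^ 2 / 2 - (i : ℝ) * t ^ 3 / 6)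
      (ψ' := fun t => 1 + t - (i : ℝ) * t ^ 2 / 2) (fun t => ?_) x y i).const_add u
    have := ((hasDerivAt_id t).add ((hasDerivAt_pow 2 t).div_const 2)).sub
      (((hasDerivAt_pow 3 t).const_mul (i : ℝ)).div_const 6)
    refine this.congr_deriv ?_
    norm_num
    ring
  rw [h.fderiv]
  simp [e, Pi.single_apply, sum_apply]

lemma pderiv_regularFun_two (b a : Fin n) (y : Space n) : pderiv (regularFun x u) ![b, a] y =
    if a = b then 1 - (a : ℝ) * (y a - x a) else 0 := by
  have h := fderiv_pderiv (contDiff_regularFun x u) ![a] y b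
  rw [funext (pderiv_regularFun_one x u a), (hasFDerivAt_coord
    (ψ := fun t => 1 + t - (a : ℝ) * t ^ 2 / 2) (ψ' := fun t => 1 - (a : ℝ) * t)
    (fun t => ?_) x y a).fderiv] at h
  · refine h.symm.trans ?_
    simp [e, Pi.single_apply]
  · have := ((hasDerivAt_id t).const_add 1).sub
      (((hasDerivAt_pow 2 t).const_mul (a : ℝ)).div_const 2)
    refine this.congr_deriv ?_
    norm_num
    ring

lemma pderiv_regularFun_three (d b a : Fin n) (y : Space n) :
    pderiv (regularFun x u) ![d, b, a] y = if a = b then (if a = d then -(a : ℝ) else 0) else 0 := by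
  have h := fderiv_pderiv (contDiff_regularFun x u) ![b, a] y d
  rw [funext (pderiv_regularFun_two x u b a)] at h
  refine h.symm.trans ?_
  split_ifs with h1 h2
  · rw [(hasFDerivAt_coord (ψ := fun t => 1 - (a : ℝ) * t) (ψ' := fun t => -(a : ℝ))
      (fun t => by simpa using ((hasDerivAt_id t).const_mul (a : ℝ)).const_sub 1) x y a).fderiv]
    simp [e, h2]
  · rw [(hasFDerivAt_coord (ψ := fun t => 1 - (a : ℝ) * t) (ψ' := fun t => -(a : ℝ))
      (fun t => by simpa using ((hasDerivAt_id t).const_mul (a : ℝ)).const_sub 1) x y a).fderiv]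
    simp [e, h2]
  · simp

/-- At `x` the Hessian is the identity, v₁ = (1, …, 1) and, as σ_3 = -D³f, A = diag(0, …, n - 1).
The frame is then a Vandermonde matrix with distinct nodes. -/
lemma isRegularAt_regularFun : IsRegularAt (regularFun x u) x := by
  set f : SmoothFun n := ⟨regularFun x u, contDiff_regularFun x u⟩
  have hh : hess f.1 x = 1 := by
    ext i j
    rw [hess_eq_pderiv, pderiv_regularFun_two]
    simp [Matrix.one_apply, eq_comm]
  have hx : (hess f.1 x).det ≠ 0 := by simp [hh]
  have hv : vOne f.1 x = fun _ => 1 := by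
    rw [vOne_eq f x hx, hh, inv_one, Matrix.one_mulVec]
    ext i
    rw [momentum_eq_pderiv, pderiv_regularFun_one]
    simp
  have hA : endoA f.1 x = Matrix.diagonal fun i : Fin n => (i : ℝ) := by
    rw [endoA_eq f x hx, hh, inv_one, Matrix.one_mul]
    ext i j
    simp only [sigmaThree_apply, sigmaCoord_three f x hx, hv, f, pderiv_regularFun_three]
    by_cases h : j = i
    · subst h; simp
    · simp [h, Matrix.diagonal_apply_ne' _ h]
  refine ⟨hx, ?_⟩
  have hfr : frame f.1 x =
      (Matrix.vandermonde fun i : Fin n => (i : ℝ)).transpose := by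
    ext i j
    rw [frame, hA, Matrix.diagonal_pow, hv, Matrix.mulVec_diagonal]
    simp [Matrix.vandermonde]
  change LinearIndependent ℝ (frame f.1 x)
  rw [hfr]
  refine Matrix.linearIndependent_rows_of_det_ne_zero ?_
  rw [Matrix.det_transpose, Matrix.det_vandermonde_ne_zero_iff]
  intro i j h
  exact Fin.ext (by simpa using h)

end regularFun

/-! ### Regular jets and invariance of the frame coefficients -/

lemma exists_regularPoly (n : ℕ) : ∃ R : MvPolynomial (FiberIndex n 3) ℝ,
    ∀ f : SmoothFun n, ∀ x, IsRegularAt f.1 x ↔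
      MvPolynomial.eval (jet 3 f.1 x).fiber R ≠ 0 := by
  have hd : (fun p : Nondeg n => (Matrix.of (frame p.1.1.1 p.1.2)).det) ∈ jetAlgebra n 3 :=
    det_mem_subalgebra _ _ fun i a => frame_mem_jetAlgebra i a
  obtain ⟨N, P, hP⟩ := exists_poly_of_mem_jetAlgebra (by norm_num) hd
  -- `P` describes the frame determinant only where the Hessian is invertible; the second factor
  -- imposes that condition.
  refine ⟨P * hessPoly n (by norm_num), fun f x => ?_⟩
  rw [map_mul, eval_hessPoly, mul_ne_zero_iff, IsRegularAt, and_comm]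
  refine and_congr_left fun hx => ?_
  rw [← hP ⟨(f, x), hx⟩]
  have h := Matrix.linearIndependent_rows_iff_isUnit (A := Matrix.of (frame f.1 x))
  rw [Matrix.isUnit_iff_isUnit_det, isUnit_iff_ne_zero] at h
  refine h.trans ?_
  simp [hx]

lemma evalJet_map {n k : ℕ} (P : MvPolynomial (FiberIndex n k) ℝ) (z : JetCoord n k) :
    evalJet (MvPolynomial.map (algebraMap ℝ (Space n × ℝ → ℝ)) P) z =
      MvPolynomial.eval z.fiber P := by
  rw [evalJet, MvPolynomial.eval₂_map]
  rfl

lemma exists_rationalJetFunction_generator {n : ℕ} (I : GenIndex n) :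
    ∃ φ : RationalJetFunction n 2 (max 3 (I.1 + 2)), φ.IsInvariant ∧
      ∀ (f : Space n → ℝ) (x : Space n), ContDiff ℝ ∞ f → (hess f x).det ≠ 0 →
        φ.IsDefinedAt (jet (max 3 (I.1 + 2)) f x) ∧
          φ.val (jet (max 3 (I.1 + 2)) f x) = generator f x I := by
  have hmem := generator_mem_jetAlgebra I
  have hk : 2 ≤ max 3 (I.1 + 2) := by omega
  generalize max 3 (I.1 + 2) = k at hmem hk ⊢
  obtain ⟨N, P, hP⟩ := exists_poly_of_mem_jetAlgebra hk hmem
  have hsm : ∀ (Q : MvPolynomial (FiberIndex n k) ℝ) m, ContDiff ℝ ∞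
      ((MvPolynomial.map (algebraMap ℝ (Space n × ℝ → ℝ)) Q).coeff m) := fun Q m => by
    rw [MvPolynomial.coeff_map]
    exact contDiff_const
  let φ : RationalJetFunction n 2 k :=
    -- The extra Hessian factor above and below makes the domain exactly the nondegenerate jets,
    -- also when `N = 0`.
    { num := MvPolynomial.map (algebraMap ℝ (Space n × ℝ → ℝ)) (P * hessPoly n hk)
      den := MvPolynomial.map (algebraMap ℝ (Space n × ℝ → ℝ)) (hessPoly n hk ^ (N + 1))
      num_smooth := hsm _
      den_smooth := hsm _
      den_order := fun τ hτ => MvPolynomial.mem_supported.1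
        (Subalgebra.pow_mem _ (hessPoly_mem_supported hk) (N + 1))
        (MvPolynomial.vars_map _ _ hτ)
      den_ne := fun x u => ⟨jet k (regularFun x u) x, ⟨_, x, contDiff_regularFun x u, rfl⟩, rfl,
        regularFun_self x u, by
          rw [evalJet_map, map_pow, eval_hessPoly]
          exact pow_ne_zero _ (isRegularAt_regularFun x u).1⟩ }
  have hdef : ∀ f x, φ.IsDefinedAt (jet k f x) ↔ (hess f x).det ≠ 0 := fun f x => by
    change evalJet (MvPolynomial.map _ _) _ ≠ 0 ↔ _
    rw [evalJet_map, map_pow, eval_hessPoly]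
    simp
  have hval : ∀ (f : SmoothFun n) x, (hess f.1 x).det ≠ 0 →
      φ.val (jet k f.1 x) = generator f.1 x I := fun f x hx => by
    change evalJet (MvPolynomial.map _ _) _ / evalJet (MvPolynomial.map _ _) _ = _
    rw [evalJet_map, evalJet_map, map_pow, map_mul, eval_hessPoly, ← hP ⟨(f, x), hx⟩]
    field_simp
    ring
  refine ⟨φ, ?_, fun f x hf hx => ⟨(hdef f x).2 hx, hval ⟨f, hf⟩ x hx⟩⟩
  rintro _ _ ⟨f, x, g, hf, rfl, rfl⟩ h1 -
  have hx := (hdef f x).1 h1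
  rw [hval ⟨f, hf⟩ x hx, hval ⟨f ∘ g.symm, contDiff_comp_symm hf g⟩ (g x)
    ((hess_det_comp_symm hf g x).2 hx), generator_comp_symm ⟨f, hf⟩ g x hx]

/-! ### Normalization by the frame -/

section Normalize

variable {n : ℕ}

lemma exists_aff (x : Space n) {w : Fin n → Space n} (hw : LinearIndependent ℝ w) :
    ∃ g : Aff n, g x = 0 ∧ ∀ i, g.linear.symm (e i) = w i := by
  have hspan : ⊤ ≤ Submodule.span ℝ (Set.range w) :=
    (hw.span_eq_top_of_card_eq_finrank' (by simp)).ge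
  let L : Space n ≃ₗ[ℝ] Space n := (Module.Basis.mk hw hspan).equivFun.symm
  -- The inverse of `g` is y ↦ x + L y, where L carries the standard basis to `w`.
  refine ⟨(L.toAffineEquiv.trans (AffineEquiv.constVAdd ℝ (Space n) x)).symm, ?_, fun i => ?_⟩
  · rw [AffineEquiv.symm_apply_eq]
    simp
  · change L (e i) = w i
    simp [L, e]

/-- Pairs `(f, x)` such that the jet of `f` at `x` is regular. -/
abbrev Reg (n : ℕ) : Type := {p : SmoothFun n × Space n // IsRegularAt p.1.1 p.2}

/-- An affine map taking the frame to the standard basis. -/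
noncomputable def normAff (p : Reg n) : Aff n := (exists_aff p.1.2 p.2.2).choose

lemma normAff_symm_e (p : Reg n) (i : Fin n) :
    (normAff p).linear.symm (e i) = frame p.1.1.1 p.1.2 i :=
  (exists_aff p.1.2 p.2.2).choose_spec.2 i

/-- The normalized jet, in which the frame is the standard basis. -/
noncomputable def normalize (p : Reg n) : Nondeg n :=
  ⟨(⟨p.1.1.1 ∘ (normAff p).symm, contDiff_comp_symm p.1.1.2 _⟩, normAff p p.1.2),
    (hess_det_comp_symm p.1.1.2 _ _).2 p.2.1⟩

lemma pderiv_normalize {k : ℕ} (p : Reg n) (τ : Fin k → Fin n) :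
    pderiv (normalize p).1.1.1 τ (normalize p).1.2 =
      iteratedFDeriv ℝ k p.1.1.1 p.1.2 (fun r => frame p.1.1.1 p.1.2 (τ r)) := by
  simp only [normalize, pderiv_comp_symm p.1.1.2, normAff_symm_e]

lemma sigmaCoord_normalize {k : ℕ} (p : Reg n) (τ : Fin k → Fin n) :
    sigmaCoord (normalize p).1.1.1 (normalize p).1.2 τ =
      sigma p.1.1.1 p.1.2 (fun r => frame p.1.1.1 p.1.2 (τ r)) := by
  rw [← sigma_comp_symm p.1.1 (normAff p) p.1.2 p.2.1]
  simp only [← normAff_symm_e, LinearEquiv.apply_symm_apply]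
  rfl

/-- The label of `σ₂(v_i, v_j)`. -/
def genTwo (i j : Fin n) : GenIndex n :=
  ⟨0, ![min i j, max i j], by
    intro a b h
    fin_cases a <;> fin_cases b <;> simp_all⟩

lemma hess_normalize (p : Reg n) (i j : Fin n) :
    hess (normalize p).1.1.1 (normalize p).1.2 i j = generator p.1.1.1 p.1.2 (genTwo i j) := by
  have h : hess (normalize p).1.1.1 (normalize p).1.2 i j =
      hess (normalize p).1.1.1 (normalize p).1.2 (min i j) (max i j) := by
    rcases le_total i j with h | h
    · rw [min_eq_left h, max_eq_right h]
    · rw [min_eq_right h, max_eq_left h, hess_symm (normalize p).1.1.2]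
  rw [h, hess_eq_pderiv, ← sigmaCoord_two _ _ (normalize p).2, sigmaCoord_normalize]
  rfl

/-- Since λ = H v₁ and v₁ becomes the first basis vector, λ_i is the entry σ_2(v₁, v_i); momenta
need no generators of their own. -/
lemma momentum_normalize (hn : 0 < n) (p : Reg n) (i : Fin n) :
    pderiv (normalize p).1.1.1 ![i] (normalize p).1.2 =
      generator p.1.1.1 p.1.2 (genTwo ⟨0, hn⟩ i) := by
  have h1 : vOne (normalize p).1.1.1 (normalize p).1.2 = e ⟨0, hn⟩ := by
    have h2 : vOne (normalize p).1.1.1 (normalize p).1.2 =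
        (normAff p).linear (vOne p.1.1.1 p.1.2) := vOne_comp_symm p.1.1 _ _ p.2.1
    have h3 : vOne p.1.1.1 p.1.2 = frame p.1.1.1 p.1.2 ⟨0, hn⟩ := by simp [frame]
    rw [h2, h3, ← normAff_symm_e, LinearEquiv.apply_symm_apply]
  rw [vOne_eq _ _ (normalize p).2] at h1
  have h4 := congrArg (hess (normalize p).1.1.1 (normalize p).1.2).mulVec h1
  rw [Matrix.mulVec_mulVec, Matrix.mul_nonsing_inv _ (isUnit_iff_ne_zero.2 (normalize p).2),
    Matrix.one_mulVec] at h4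
  rw [← momentum_eq_pderiv, h4, mulVec_e, hess_symm (normalize p).1.1.2, hess_normalize]

/-! ### Derivatives along the frame, with powers of the Gram determinant as denominators -/

/-- The Gram determinant of the frame with respect to `σ₂`. -/
noncomputable def gramDet (p : Reg n) : ℝ := (hess (normalize p).1.1.1 (normalize p).1.2).det

lemma gramDet_ne_zero (p : Reg n) : gramDet p ≠ 0 := (normalize p).2

/-- The Gram determinant as a polynomial in the frame coefficients. -/
noncomputable def gramPoly (n : ℕ) : MvPolynomial (GenIndex n) ℝ :=
  (Matrix.of fun i j : Fin n => (MvPolynomial.X (genTwo i j) : MvPolynomial (GenIndex n) ℝ)).det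

lemma eval_gramPoly (p : Reg n) :
    MvPolynomial.eval (generator p.1.1.1 p.1.2) (gramPoly n) = gramDet p := by
  rw [gramPoly, RingHom.map_det, gramDet]
  congr 1
  ext i j
  simp [hess_normalize]

lemma gramPoly_mem_supported {m : ℕ} (hm : 2 ≤ m) :
    gramPoly n ∈ MvPolynomial.supported ℝ {I : GenIndex n | I.1 + 2 ≤ m} := by
  rw [gramPoly, Matrix.det_apply]
  refine Subalgebra.sum_mem _ fun s _ => ?_
  rw [Units.smul_def]
  refine Subalgebra.zsmul_mem _ (Subalgebra.prod_mem _ fun i _ => ?_) _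
  rw [Matrix.of_apply, MvPolynomial.supported_eq_adjoin_X]
  exact Algebra.subset_adjoin ⟨_, by simpa [genTwo] using hm, rfl⟩

/-- Evaluation of polynomials in the frame coefficients, as functions of regular jets. -/
noncomputable def genHom (n : ℕ) : MvPolynomial (GenIndex n) ℝ →ₐ[ℝ] (Reg n → ℝ) :=
  AlgHom.pi fun p => MvPolynomial.aeval (generator p.1.1.1 p.1.2)

lemma genHom_apply (P : MvPolynomial (GenIndex n) ℝ) (p : Reg n) :
    genHom n P p = MvPolynomial.eval (generator p.1.1.1 p.1.2) P := by
  simp [genHom, MvPolynomial.aeval_eq_eval]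

/-- The derivatives of `f` along the frame are rational functions of the frame coefficients. -/
lemma exists_genPoly {k : ℕ} (hk : 1 ≤ k) (τ : Fin k → Fin n) :
    ∃ (N : ℕ) (q : MvPolynomial (GenIndex n) ℝ),
      q ∈ MvPolynomial.supported ℝ {I : GenIndex n | I.1 + 2 ≤ max k 2} ∧
      ∀ p : Reg n, MvPolynomial.eval (generator p.1.1.1 p.1.2) q =
        iteratedFDeriv ℝ k p.1.1.1 p.1.2 (fun r => frame p.1.1.1 p.1.2 (τ r)) *
          gramDet p ^ N := by
  set s : Set (Reg n → ℝ) := genHom n '' (MvPolynomial.X '' {I : GenIndex n | I.1 + 2 ≤ max k 2})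
  have hs : ∀ I : GenIndex n, I.1 + 2 ≤ max k 2 → (fun p : Reg n => generator p.1.1.1 p.1.2 I) ∈ s :=
    fun I hI => ⟨_, ⟨I, hI, rfl⟩, by ext p; simp [genHom_apply]⟩
  have hadj : Algebra.adjoin ℝ s =
      (MvPolynomial.supported ℝ {I : GenIndex n | I.1 + 2 ≤ max k 2}).map (genHom n) := by
    rw [MvPolynomial.supported_eq_adjoin_X, AlgHom.map_adjoin]
  let Φ : (Nondeg n → ℝ) →ₐ[ℝ] (Reg n → ℝ) :=
    AlgHom.pi fun p => Pi.evalAlgHom ℝ (fun _ => ℝ) (normalize p)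
  have hle : sigmaAlgebra n k ≤ (Algebra.adjoin ℝ (s ∪ {fun p => (gramDet p)⁻¹})).comap Φ := by
    refine Algebra.adjoin_le ?_
    rintro F ((⟨i, rfl⟩ | ⟨I, h1, rfl⟩) | rfl)
    -- Momenta are coefficients of σ_2, which forces order 2 in the bound `max k 2` even when k = 1.
    · have hn : 0 < n := i.pos
      refine Algebra.subset_adjoin (Or.inl ?_)
      convert hs (genTwo ⟨0, hn⟩ i) (by simp [genTwo]) using 1
      ext p
      exact momentum_normalize hn p i
    · refine Algebra.subset_adjoin (Or.inl ?_)
      convert hs I (h1.trans (le_max_left _ _)) using 1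
      ext p
      exact sigmaCoord_normalize p _
    · exact Algebra.subset_adjoin (Or.inr rfl)
  have hgram : gramDet ∈ Algebra.adjoin ℝ s := by
    rw [hadj]
    refine ⟨gramPoly n, gramPoly_mem_supported (le_max_right _ _), ?_⟩
    ext p
    exact (genHom_apply _ p).trans (eval_gramPoly p)
  obtain ⟨N, hN⟩ := exists_mul_pow_mem s hgram (d' := fun p => (gramDet p)⁻¹)
    (by ext p; exact mul_inv_cancel₀ (gramDet_ne_zero p)) (hle (pderiv_mem_sigmaAlgebra hk τ))
  rw [hadj] at hN
  obtain ⟨q, hq, hq'⟩ := hN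
  refine ⟨N, q, hq, fun p => ?_⟩
  rw [← genHom_apply, ← pderiv_normalize]
  exact congrFun hq' p

/-- With one exponent `s` for all labels and the power proportional to the order, the denominators
can be absorbed by rescaling each frame vector by `gramDet p ^ s`. -/
lemma exists_genPoly_uniform (n k : ℕ) :
    ∃ (s : ℕ) (q : FiberIndex n k → MvPolynomial (GenIndex n) ℝ),
      (∀ τ, q τ ∈ MvPolynomial.supported ℝ {I : GenIndex n | I.1 + 2 ≤ max (τ.1.1 + 1) 2}) ∧
      ∀ τ (p : Reg n), MvPolynomial.eval (generator p.1.1.1 p.1.2) (q τ) =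
        iteratedFDeriv ℝ (τ.1.1 + 1) p.1.1.1 p.1.2 (fun r => frame p.1.1.1 p.1.2 (τ.2 r)) *
          (gramDet p ^ s) ^ (τ.1.1 + 1) := by
  choose N q h1 h2 using fun τ : FiberIndex n k => exists_genPoly (Nat.le_add_left 1 τ.1.1) τ.2
  -- The sum of the exponents dominates each `N τ`, and `gramPoly` supplies the missing powers.
  refine ⟨∑ τ, N τ, fun τ => q τ * gramPoly n ^ ((∑ τ, N τ) * (τ.1.1 + 1) - N τ), fun τ =>
    Subalgebra.mul_mem _ (h1 τ) (Subalgebra.pow_mem _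
      (gramPoly_mem_supported (le_max_right _ _)) _), fun τ p => ?_⟩
  have hle : N τ ≤ (∑ τ, N τ) * (τ.1.1 + 1) :=
    (Finset.single_le_sum (fun _ _ => Nat.zero_le _) (Finset.mem_univ τ)).trans
      (Nat.le_mul_of_pos_right _ (Nat.succ_pos _))
  rw [map_mul, h2, map_pow, eval_gramPoly, mul_assoc, ← pow_add, ← pow_mul,
    Nat.add_sub_cancel' hle]

end Normalize

/-! ### Polynomials with restricted coefficients -/

/-- Polynomials with coefficients in a subring. -/
def coeffSubring (σ : Type*) {R : Type*} [CommRing R] (S : Subring R) :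
    Subring (MvPolynomial σ R) where
  carrier := {p | ∀ m, p.coeff m ∈ S}
  mul_mem' {p q} hp hq m := by
    classical
    rw [MvPolynomial.coeff_mul]
    exact S.sum_mem fun i _ => S.mul_mem (hp _) (hq _)
  one_mem' m := by
    classical
    rw [MvPolynomial.coeff_one]
    split_ifs
    exacts [S.one_mem, S.zero_mem]
  add_mem' {p q} hp hq m := by
    rw [MvPolynomial.coeff_add]
    exact S.add_mem (hp m) (hq m)
  zero_mem' m := by
    rw [MvPolynomial.coeff_zero]
    exact S.zero_mem
  neg_mem' {p} hp m := by
    rw [MvPolynomial.coeff_neg]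
    exact S.neg_mem (hp m)

lemma X_mem_coeffSubring {σ R : Type*} [CommRing R] (S : Subring R) (i : σ) :
    MvPolynomial.X i ∈ coeffSubring σ S := fun m => by
  classical
  rw [MvPolynomial.coeff_X]
  split_ifs
  exacts [S.one_mem, S.zero_mem]

lemma C_mem_coeffSubring {σ R : Type*} [CommRing R] {S : Subring R} {r : R} (hr : r ∈ S) :
    MvPolynomial.C r ∈ coeffSubring σ S := fun m => by
  classical
  rw [MvPolynomial.coeff_C]
  split_ifs
  exacts [hr, S.zero_mem]

lemma eval₂_mem_subring {σ R A : Type*} [CommRing R] [CommRing A] (S : Subring A) (f : R →+* A)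
    (t : σ → A) (p : MvPolynomial σ R) (hf : ∀ m, f (p.coeff m) ∈ S) (ht : ∀ i ∈ p.vars, t i ∈ S) :
    MvPolynomial.eval₂ f t p ∈ S := by
  rw [MvPolynomial.eval₂_eq]
  exact S.sum_mem fun d hd => S.mul_mem (hf d) (S.prod_mem fun i hi =>
    S.pow_mem (ht i ((MvPolynomial.mem_vars_iff_mem_support i).2 ⟨d, hd, hi⟩)) _)

/-- Smooth functions of one variable. -/
def smoothSubring : Subring (ℝ → ℝ) where
  carrier := {f | ContDiff ℝ ∞ f}
  mul_mem' {f g} (hf : ContDiff ℝ ∞ f) (hg : ContDiff ℝ ∞ g) := hf.mul hg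
  one_mem' := (contDiff_const : ContDiff ℝ ∞ fun _ : ℝ => (1 : ℝ))
  add_mem' {f g} (hf : ContDiff ℝ ∞ f) (hg : ContDiff ℝ ∞ g) := hf.add hg
  zero_mem' := (contDiff_const : ContDiff ℝ ∞ fun _ : ℝ => (0 : ℝ))
  neg_mem' {f} (hf : ContDiff ℝ ∞ f) := hf.neg

lemma mem_smoothSubring {f : ℝ → ℝ} : f ∈ smoothSubring ↔ ContDiff ℝ ∞ f := Iff.rfl

/-- Polynomials in the frame coefficients with labels in `s`, with smooth functions of `u` as
coefficients. -/
noncomputable def genSubring (n : ℕ) (s : Set (GenIndex n)) : Subring (MvPolynomial (GenIndex n) (ℝ → ℝ)) :=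
  coeffSubring (GenIndex n) smoothSubring ⊓ (MvPolynomial.supported (ℝ → ℝ) s).toSubring

lemma map_mem_genSubring {n : ℕ} {s : Set (GenIndex n)} {q : MvPolynomial (GenIndex n) ℝ}
    (hq : q ∈ MvPolynomial.supported ℝ s) :
    MvPolynomial.map (algebraMap ℝ (ℝ → ℝ)) q ∈ genSubring n s := by
  refine ⟨fun m => ?_, ?_⟩
  · rw [MvPolynomial.coeff_map]
    exact mem_smoothSubring.2 (contDiff_const (c := algebraMap ℝ ℝ (q.coeff m)))
  · exact MvPolynomial.mem_supported.2 fun i hi =>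
      MvPolynomial.mem_supported.1 hq (MvPolynomial.vars_map _ _ hi)

lemma C_mem_genSubring {n : ℕ} (s : Set (GenIndex n)) {a : ℝ → ℝ} (ha : ContDiff ℝ ∞ a) :
    MvPolynomial.C a ∈ genSubring n s :=
  ⟨C_mem_coeffSubring (mem_smoothSubring.2 ha), Subalgebra.algebraMap_mem _ a⟩

/-! ### Invariants in terms of the frame coefficients -/

section Generate

variable {n k : ℕ}

/-- Polynomials in the entries of a square matrix and in the frame coefficients. -/
abbrev MatGenPoly (n : ℕ) : Type :=
  MvPolynomial (Fin n × Fin n) (MvPolynomial (GenIndex n) (ℝ → ℝ))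

/-- Evaluation of polynomials in the frame coefficients at a jet. -/
noncomputable def evalGenHom (f : Space n → ℝ) (x : Space n) :
    MvPolynomial (GenIndex n) (ℝ → ℝ) →+* ℝ :=
  MvPolynomial.eval₂Hom (Pi.evalRingHom (fun _ : ℝ => ℝ) (f x)) (generator f x)

lemma evalGenHom_apply (f : Space n → ℝ) (x : Space n) (P : MvPolynomial (GenIndex n) (ℝ → ℝ)) :
    evalGenHom f x P = evalGen P f x := rfl

/-- Evaluation at a jet and a matrix. -/
noncomputable def evalMat (f : Space n → ℝ) (x : Space n) (h : Fin n × Fin n → ℝ) :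
    MatGenPoly n →+* ℝ :=
  MvPolynomial.eval₂Hom (evalGenHom f x) h

lemma evalMat_eq_eval_map (f : Space n → ℝ) (x : Space n) (h : Fin n × Fin n → ℝ)
    (P : MatGenPoly n) :
    evalMat f x h P = MvPolynomial.eval h (MvPolynomial.map (evalGenHom f x) P) := by
  rw [MvPolynomial.eval_map]
  rfl

/-- The fibre coordinates of the jet in the basis `∑ a, h a c • v_a` (up to a scalar factor), as
polynomials in `h` and the frame coefficients. -/
noncomputable def fiberPoly (q : FiberIndex n k → MvPolynomial (GenIndex n) ℝ)
    (τ : FiberIndex n k) : MatGenPoly n :=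
  ∑ ρ : Fin (τ.1.1 + 1) → Fin n, (∏ r, MvPolynomial.X (ρ r, τ.2 r)) *
    MvPolynomial.C (MvPolynomial.map (algebraMap ℝ (ℝ → ℝ)) (q ⟨τ.1, ρ⟩))

/-- Restriction of functions of `(x, u)` to `x = 0`. -/
def restrictZero (n : ℕ) : (Space n × ℝ → ℝ) →+* (ℝ → ℝ) where
  toFun a u := a (0, u)
  map_one' := rfl
  map_mul' _ _ := rfl
  map_zero' := rfl
  map_add' _ _ := rfl

/-- Substitution of `fiberPoly` for the fibre coordinates and of `0` for `x`. -/
noncomputable def liftPoly (q : FiberIndex n k → MvPolynomial (GenIndex n) ℝ)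
    (P : MvPolynomial (FiberIndex n k) (Space n × ℝ → ℝ)) : MatGenPoly n :=
  MvPolynomial.eval₂ ((MvPolynomial.C.comp MvPolynomial.C).comp (restrictZero n)) (fiberPoly q) P

lemma evalMat_liftPoly (q : FiberIndex n k → MvPolynomial (GenIndex n) ℝ)
    (P : MvPolynomial (FiberIndex n k) (Space n × ℝ → ℝ)) (f : Space n → ℝ) (x : Space n)
    (h : Fin n × Fin n → ℝ) : evalMat f x h (liftPoly q P) =
      evalJet P ⟨0, f x, fun τ => evalMat f x h (fiberPoly q τ)⟩ := by
  rw [liftPoly, MvPolynomial.hom_eval₂, evalJet]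
  congr 1
  ext a
  simp [evalMat, evalGenHom, restrictZero]

/-- A change of basis mixes the indices of a fibre coordinate but keeps its order, so all `ρ` enter,
and a bound on the order of `P` survives. -/
lemma liftPoly_mem {q : FiberIndex n k → MvPolynomial (GenIndex n) ℝ}
    {P : MvPolynomial (FiberIndex n k) (Space n × ℝ → ℝ)} {s : Set (GenIndex n)}
    (hP : ∀ m, ContDiff ℝ ∞ (P.coeff m))
    (hq : ∀ τ ∈ P.vars, ∀ ρ, q ⟨τ.1, ρ⟩ ∈ MvPolynomial.supported ℝ s) :
    liftPoly q P ∈ coeffSubring (Fin n × Fin n) (genSubring n s) := by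
  refine eval₂_mem_subring _ _ _ _ (fun m => C_mem_coeffSubring (C_mem_genSubring s ?_))
    fun τ hτ => Subring.sum_mem _ fun ρ _ => Subring.mul_mem _
      (Subring.prod_mem _ fun r _ => X_mem_coeffSubring _ _)
      (C_mem_coeffSubring (map_mem_genSubring (hq τ hτ ρ)))
  exact (hP m).comp (contDiff_prodMk_right (0 : Space n))

/-- The vectors `∑ a, c h_{a i} v_a`. -/
noncomputable def mixedFrame (f : Space n → ℝ) (x : Space n) (c : ℝ) (h : Fin n × Fin n → ℝ)
    (i : Fin n) : Space n :=
  ∑ a, (c * h (a, i)) • frame f x a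

/-- Multilinearity spreads the factor (gramDet^s)^j over the j arguments, one power for each vector.
-/
lemma evalMat_fiberPoly {s : ℕ} {q : FiberIndex n k → MvPolynomial (GenIndex n) ℝ}
    (hq : ∀ τ (p : Reg n), MvPolynomial.eval (generator p.1.1.1 p.1.2) (q τ) =
        iteratedFDeriv ℝ (τ.1.1 + 1) p.1.1.1 p.1.2 (fun r => frame p.1.1.1 p.1.2 (τ.2 r)) *
          (gramDet p ^ s) ^ (τ.1.1 + 1)) (p : Reg n) (h : Fin n × Fin n → ℝ)
    (τ : FiberIndex n k) : evalMat p.1.1.1 p.1.2 h (fiberPoly q τ) =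
      iteratedFDeriv ℝ (τ.1.1 + 1) p.1.1.1 p.1.2
        (fun r => mixedFrame p.1.1.1 p.1.2 (gramDet p ^ s) h (τ.2 r)) := by
  have h1 : ∀ Q : MvPolynomial (GenIndex n) ℝ, evalGenHom p.1.1.1 p.1.2
      (MvPolynomial.map (algebraMap ℝ (ℝ → ℝ)) Q) =
      MvPolynomial.eval (generator p.1.1.1 p.1.2) Q := fun Q => by
    simp only [evalGenHom, MvPolynomial.coe_eval₂Hom, MvPolynomial.eval₂_map]
    rfl
  simp only [mixedFrame]
  rw [ContinuousMultilinearMap.map_sum, fiberPoly, map_sum]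
  refine Finset.sum_congr rfl fun ρ _ => ?_
  rw [ContinuousMultilinearMap.map_smul_univ, map_mul, map_prod]
  simp only [evalMat, MvPolynomial.coe_eval₂Hom, MvPolynomial.eval₂_X, MvPolynomial.eval₂_C, h1,
    hq, Finset.prod_mul_distrib, Finset.prod_const, Finset.card_univ, Fintype.card_fin, smul_eq_mul]
  ring

lemma linearIndependent_mixedFrame (p : Reg n) {c : ℝ} (hc : c ≠ 0) {h : Fin n × Fin n → ℝ}
    (hh : (Matrix.of fun i j => h (i, j)).det ≠ 0) :
    LinearIndependent ℝ (mixedFrame p.1.1.1 p.1.2 c h) := by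
  have h1 : mixedFrame p.1.1.1 p.1.2 c h = (c • (Matrix.of fun i j => h (i, j)).transpose) *
      Matrix.of (frame p.1.1.1 p.1.2) := by
    ext i j
    simp [mixedFrame, Matrix.mul_apply, Finset.sum_apply]
  have h2 : (Matrix.of (frame p.1.1.1 p.1.2)).det ≠ 0 := by
    rw [← isUnit_iff_ne_zero, ← Matrix.isUnit_iff_isUnit_det,
      ← Matrix.linearIndependent_rows_iff_isUnit]
    exact p.2.2
  rw [h1]
  refine Matrix.linearIndependent_rows_of_det_ne_zero ?_
  rw [Matrix.det_mul, Matrix.det_smul, Matrix.det_transpose]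
  exact mul_ne_zero (mul_ne_zero (pow_ne_zero _ hc) hh) h2

/-- Specializing to this `h`, the inverse frame matrix up to transposition and scale, recovers the
fibre coordinates of the given jet, so a nonzero value of the original denominator is detected. -/
lemma exists_mixedFrame_eq_e (p : Reg n) {c : ℝ} (hc : c ≠ 0) :
    ∃ h : Fin n × Fin n → ℝ, mixedFrame p.1.1.1 p.1.2 c h = e := by
  set V := Matrix.of (frame p.1.1.1 p.1.2)
  have hV : IsUnit V.det := by
    rw [← Matrix.isUnit_iff_isUnit_det, ← Matrix.linearIndependent_rows_iff_isUnit]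
    exact p.2.2
  refine ⟨fun a => c⁻¹ * V⁻¹ a.2 a.1, ?_⟩
  ext i j
  have h1 := congrFun (congrFun (Matrix.nonsing_inv_mul V hV) i) j
  rw [Matrix.mul_apply] at h1
  simp only [mixedFrame, Finset.sum_apply, Pi.smul_apply, smul_eq_mul, mul_inv_cancel_left₀ hc]
  refine h1.trans ?_
  simp [e, Matrix.one_apply, Pi.single_apply, eq_comm]

lemma jet_comp_symm {f : Space n → ℝ} (hf : ContDiff ℝ ∞ f) (g : Aff n) (x : Space n) :
    jet k (f ∘ g.symm) (g x) = ⟨g x, f x, fun τ =>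
      iteratedFDeriv ℝ (τ.1.1 + 1) f x (fun r => g.linear.symm (e (τ.2 r)))⟩ := by
  simp only [jet, iteratedFDeriv_comp_symm hf]
  simp

/-- Numerator and denominator of an invariant, written in the frame coefficients. -/
lemma map_liftPoly_eq {l s : ℕ} {q : FiberIndex n k → MvPolynomial (GenIndex n) ℝ}
    (hq : ∀ τ (p : Reg n), MvPolynomial.eval (generator p.1.1.1 p.1.2) (q τ) =
        iteratedFDeriv ℝ (τ.1.1 + 1) p.1.1.1 p.1.2 (fun r => frame p.1.1.1 p.1.2 (τ.2 r)) *
          (gramDet p ^ s) ^ (τ.1.1 + 1))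
    {φ : RationalJetFunction n l k} (hφ : φ.IsInvariant) (p : Reg n)
    (hdef : φ.IsDefinedAt (jet k p.1.1.1 p.1.2))
    (hD : MvPolynomial.map (evalGenHom p.1.1.1 p.1.2) (liftPoly q φ.den) ≠ 0) :
    MvPolynomial.map (evalGenHom p.1.1.1 p.1.2) (liftPoly q φ.num) =
      MvPolynomial.C (φ.val (jet k p.1.1.1 p.1.2)) *
        MvPolynomial.map (evalGenHom p.1.1.1 p.1.2) (liftPoly q φ.den) := by
  set N' := MvPolynomial.map (evalGenHom p.1.1.1 p.1.2) (liftPoly q φ.num) with hN'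
  set D' := MvPolynomial.map (evalGenHom p.1.1.1 p.1.2) (liftPoly q φ.den) with hD'
  set v := φ.val (jet k p.1.1.1 p.1.2) with hv
  have hX : (Matrix.mvPolynomialX (Fin n) (Fin n) ℝ).det ≠ 0 :=
    Matrix.det_mvPolynomialX_ne_zero (Fin n) ℝ
  -- The last two factors make the identity true at every real `h`: where both are nonzero, `h`
  -- defines an affine map carrying the mixed frame to the standard basis, and invariance applies. A
  -- polynomial over ℝ vanishing everywhere is zero, and both factors cancel.
  have key : (N' - MvPolynomial.C v * D') * D' * (Matrix.mvPolynomialX (Fin n) (Fin n) ℝ).det = 0 := by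
    refine MvPolynomial.funext fun h => ?_
    have hdet : MvPolynomial.eval h (Matrix.mvPolynomialX (Fin n) (Fin n) ℝ).det =
        (Matrix.of fun i j => h (i, j)).det := by
      rw [RingHom.map_det]
      congr 1
      ext i j
      simp [Matrix.mvPolynomialX]
    simp only [map_mul, map_sub, map_zero, MvPolynomial.eval_C, hdet]
    by_cases h1 : (Matrix.of fun i j => h (i, j)).det = 0
    · rw [h1, mul_zero]
    by_cases h2 : MvPolynomial.eval h D' = 0
    · rw [h2]; ring
    obtain ⟨g, hg0, hg⟩ := exists_aff p.1.2
      (linearIndependent_mixedFrame p (pow_ne_zero s (gramDet_ne_zero p)) h1)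
    have hjet : (⟨0, p.1.1.1 p.1.2, fun τ => evalMat p.1.1.1 p.1.2 h (fiberPoly q τ)⟩ :
        JetCoord n k) = jet k (p.1.1.1 ∘ g.symm) (g p.1.2) := by
      rw [jet_comp_symm p.1.1.2]
      simp only [hg, hg0, evalMat_fiberPoly hq]
    have hP : ∀ P, MvPolynomial.eval h (MvPolynomial.map (evalGenHom p.1.1.1 p.1.2) (liftPoly q P)) =
        evalJet P (jet k (p.1.1.1 ∘ g.symm) (g p.1.2)) := fun P => by
      rw [← evalMat_eq_eval_map, evalMat_liftPoly, hjet]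
    rw [hD', hP] at h2
    have h3 := hφ _ _ ⟨p.1.1.1, p.1.2, g, p.1.1.2, rfl, rfl⟩ hdef h2
    rw [hN', hD', hP, hP, hv, ← h3, RationalJetFunction.val, div_mul_cancel₀ _ h2]
    ring
  have h1 := (mul_eq_zero.1 key).resolve_right hX
  exact sub_eq_zero.1 ((mul_eq_zero.1 h1).resolve_right hD)

/-! ### Nonvanishing of the denominator and conclusion -/

lemma contDiff_line (f₁ f₂ : SmoothFun n) (t : ℝ) : ContDiff ℝ ∞ (f₁.1 + t • (f₂.1 - f₁.1)) :=
  f₁.2.add (contDiff_const.smul (f₂.2.sub f₁.2))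

lemma pderiv_line {m : ℕ} (f₁ f₂ : SmoothFun n) (t : ℝ) (τ : Fin m → Fin n) (x : Space n) :
    pderiv (f₁.1 + t • (f₂.1 - f₁.1)) τ x =
      pderiv f₁.1 τ x + t * (pderiv f₂.1 τ x - pderiv f₁.1 τ x) := by
  have hm : ∀ f : SmoothFun n, ContDiffAt ℝ m f.1 x := fun f =>
    (f.2.of_le (by exact_mod_cast le_top)).contDiffAt
  have hneg : ContDiffAt ℝ m (-f₁.1) x := (hm f₁).neg
  have hsub : ContDiffAt ℝ m (f₂.1 + -f₁.1) x := (hm f₂).add hneg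
  have hsmul : ContDiffAt ℝ m (t • (f₂.1 + -f₁.1)) x := hsub.const_smul t
  unfold pderiv
  rw [sub_eq_add_neg f₂.1, iteratedFDeriv_add_apply (hm f₁) hsmul,
    iteratedFDeriv_const_smul_apply hsub, iteratedFDeriv_add_apply (hm f₂) hneg,
    iteratedFDeriv_neg_apply]
  simp
  ring

/-- Regular jets at which the denominator does not vanish. -/
lemma exists_reg_evalJet_ne_zero {l : ℕ} (φ : RationalJetFunction n l k) (u : ℝ) :
    ∃ p : Reg n, p.1.2 = 0 ∧ p.1.1.1 0 = u ∧ evalJet φ.den (jet k p.1.1.1 0) ≠ 0 := by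
  obtain ⟨_, ⟨f₁, x, hf₁, rfl⟩, hx, hu, hne⟩ := φ.den_ne 0 u
  obtain rfl : x = 0 := hx
  obtain ⟨R, hR⟩ := exists_regularPoly n
  -- On the segment from `f₁` to `f₂` the value at 0 stays `u`, and the denominator and the
  -- regularity polynomial become polynomials `A`, `B` in t with A(0) ≠ 0 and B(1) ≠ 0. Some t is a
  -- root of neither.
  let f₁ : SmoothFun n := ⟨f₁, hf₁⟩
  let f₂ : SmoothFun n := ⟨regularFun 0 u, contDiff_regularFun 0 u⟩
  have hval : ∀ t : ℝ, (f₁.1 + t • (f₂.1 - f₁.1)) 0 = u := fun t => by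
    have h1 : f₁.1 0 = u := hu
    have h2 : f₂.1 0 = u := regularFun_self 0 u
    simp [h1, h2]
  let c : ∀ m : ℕ, FiberIndex n m → Polynomial ℝ := fun m τ =>
    Polynomial.C (pderiv f₁.1 τ.2 0) +
      Polynomial.X * Polynomial.C (pderiv f₂.1 τ.2 0 - pderiv f₁.1 τ.2 0)
  have hc : ∀ (m : ℕ) (t : ℝ), (fun τ => Polynomial.eval t (c m τ)) =
      (jet m (f₁.1 + t • (f₂.1 - f₁.1)) 0).fiber := fun m t => by
    ext τ
    refine Eq.trans ?_ (pderiv_line f₁ f₂ t τ.2 0).symm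
    simp [c]
  let A : Polynomial ℝ := MvPolynomial.eval₂
    (Polynomial.C.comp (Pi.evalRingHom (fun _ : Space n × ℝ => ℝ) (0, u))) (c k) φ.den
  let B : Polynomial ℝ := MvPolynomial.eval₂ Polynomial.C (c 3) R
  have hA : ∀ t, Polynomial.eval t A =
      evalJet φ.den (jet k (f₁.1 + t • (f₂.1 - f₁.1)) 0) := fun t => by
    rw [← Polynomial.coe_evalRingHom, MvPolynomial.hom_eval₂, evalJet, ← hc]
    simp only [jet, hval]
    congr 1
    ext a
    simp
  have hB : ∀ t, Polynomial.eval t B =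
      MvPolynomial.eval (jet 3 (f₁.1 + t • (f₂.1 - f₁.1)) 0).fiber R := fun t => by
    rw [← Polynomial.coe_evalRingHom, MvPolynomial.hom_eval₂, ← hc, MvPolynomial.eval,
      MvPolynomial.coe_eval₂Hom]
    congr 1
    ext a
    simp
  have hA0 : A ≠ 0 := fun h => by
    have := hA 0
    rw [h] at this
    simp only [Polynomial.eval_zero, zero_smul, add_zero] at this
    exact hne this.symm
  have hB0 : B ≠ 0 := fun h => by
    have h1 := hB 1
    rw [h] at h1
    simp only [Polynomial.eval_zero, one_smul, add_sub_cancel] at h1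
    exact (hR f₂ 0).1 (isRegularAt_regularFun 0 u) h1.symm
  obtain ⟨t, ht⟩ : ∃ t, Polynomial.eval t (A * B) ≠ 0 := by
    by_contra! h
    exact mul_ne_zero hA0 hB0 (Polynomial.funext fun t => by rw [h t, Polynomial.eval_zero])
  rw [Polynomial.eval_mul, hA, hB] at ht
  exact ⟨⟨(⟨_, contDiff_line f₁ f₂ t⟩, 0), (hR ⟨_, contDiff_line f₁ f₂ t⟩ 0).2 (right_ne_zero_of_mul ht)⟩,
    rfl, hval t, left_ne_zero_of_mul ht⟩

/-- The sum of squares of the coefficients of `D₀` serves as denominator, because no single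
coefficient need be nonzero over every u. -/
lemma exists_generators_of_isInvariant {l : ℕ} (hl : 2 ≤ l) (φ : RationalJetFunction n l k)
    (hφ : φ.IsInvariant) :
    ∃ N D : MvPolynomial (GenIndex n) (ℝ → ℝ),
      (∀ m, ContDiff ℝ ∞ (N.coeff m)) ∧ (∀ m, ContDiff ℝ ∞ (D.coeff m)) ∧
      (∀ I ∈ D.vars, I.1 + 2 ≤ l) ∧
      (∀ (x : Space n) (u : ℝ), ∃ f : Space n → ℝ,
        ContDiff ℝ ∞ f ∧ f x = u ∧ IsRegularAt f x ∧ evalGen D f x ≠ 0) ∧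
      ∀ (f : Space n → ℝ) (x : Space n), ContDiff ℝ ∞ f → IsRegularAt f x →
        φ.IsDefinedAt (jet k f x) → evalGen D f x ≠ 0 →
          φ.val (jet k f x) = evalGen N f x / evalGen D f x := by
  obtain ⟨s, q, hsupp, hq⟩ := exists_genPoly_uniform n k
  set N₀ := liftPoly q φ.num
  set D₀ := liftPoly q φ.den
  have hN₀ : N₀ ∈ coeffSubring _ (genSubring n Set.univ) :=
    liftPoly_mem φ.num_smooth fun τ _ ρ => by simp
  have hD₀ : D₀ ∈ coeffSubring _ (genSubring n {I | I.1 + 2 ≤ l}) :=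
    liftPoly_mem φ.den_smooth fun τ hτ ρ =>
      MvPolynomial.supported_mono (fun I hI => le_trans hI (max_le (φ.den_order τ hτ) hl))
        (hsupp ⟨τ.1, ρ⟩)
  have hDmem : ∑ m ∈ D₀.support, D₀.coeff m ^ 2 ∈ genSubring n {I | I.1 + 2 ≤ l} :=
    Subring.sum_mem _ fun m _ => Subring.pow_mem _ (hD₀ m) 2
  have hNmem : ∑ m ∈ D₀.support, D₀.coeff m * N₀.coeff m ∈
      coeffSubring (GenIndex n) smoothSubring :=
    Subring.sum_mem _ fun m _ => Subring.mul_mem _ (hD₀ m).1 (hN₀ m).1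
  have hDeval : ∀ (f : Space n → ℝ) x, evalGen (∑ m ∈ D₀.support, D₀.coeff m ^ 2) f x =
      ∑ m ∈ D₀.support, (evalGenHom f x (D₀.coeff m)) ^ 2 := fun f x => by
    rw [← evalGenHom_apply, map_sum]
    simp only [map_pow]
  refine ⟨∑ m ∈ D₀.support, D₀.coeff m * N₀.coeff m, ∑ m ∈ D₀.support, D₀.coeff m ^ 2,
    hNmem, hDmem.1, fun I hI => MvPolynomial.mem_supported.1 hDmem.2 hI, fun x u => ?_, ?_⟩
  · obtain ⟨p, hp0, hpu, hp⟩ := exists_reg_evalJet_ne_zero φ u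
    obtain ⟨h, hh⟩ := exists_mixedFrame_eq_e p (pow_ne_zero s (gramDet_ne_zero p))
    have h1 : evalMat p.1.1.1 p.1.2 h D₀ ≠ 0 := by
      rw [evalMat_liftPoly]
      simp only [evalMat_fiberPoly hq, hh]
      rw [hp0]
      exact hp
    have h2 : evalGen (∑ m ∈ D₀.support, D₀.coeff m ^ 2) p.1.1.1 p.1.2 ≠ 0 := by
      rw [hDeval]
      intro h3
      rw [Finset.sum_eq_zero_iff_of_nonneg fun _ _ => sq_nonneg _] at h3
      apply h1
      rw [evalMat_eq_eval_map]
      have h4 : MvPolynomial.map (evalGenHom p.1.1.1 p.1.2) D₀ = 0 := by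
        ext m
        rw [MvPolynomial.coeff_map, MvPolynomial.coeff_zero]
        by_cases hm : m ∈ D₀.support
        · exact pow_eq_zero_iff two_ne_zero |>.1 (h3 m hm)
        · rw [MvPolynomial.notMem_support_iff.1 hm, map_zero]
      rw [h4, map_zero]
    -- The denominator is affine invariant, so a translation carries the jet found over 0 to one
    -- over x.
    let g : Aff n := AffineEquiv.constVAdd ℝ (Space n) x
    have hg : g p.1.2 = x := by simp [g, hp0]
    refine ⟨p.1.1.1 ∘ g.symm, contDiff_comp_symm p.1.1.2 g, ?_, ?_, ?_⟩
    · rw [← hg, Function.comp_apply, g.symm_apply_apply, hp0, hpu]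
    · have := isRegularAt_comp_symm p.1.1 g p.1.2 p.2
      rwa [hg] at this
    · have := evalGen_comp_symm (∑ m ∈ D₀.support, D₀.coeff m ^ 2) p.1.1 g p.1.2 p.2.1
      rw [hg] at this
      rw [this]
      exact h2
  · intro f x hf hreg hdef hD
    have h1 : MvPolynomial.map (evalGenHom f x) D₀ ≠ 0 := fun h0 => by
      apply hD
      rw [hDeval]
      refine Finset.sum_eq_zero fun m _ => ?_
      rw [← MvPolynomial.coeff_map, h0]
      simp
    have h2 := map_liftPoly_eq hq hφ ⟨(⟨f, hf⟩, x), hreg⟩ hdef h1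
    have h3 : ∀ m, evalGenHom f x (N₀.coeff m) =
        φ.val (jet k f x) * evalGenHom f x (D₀.coeff m) := fun m => by
      have := congrArg (MvPolynomial.coeff m) h2
      rwa [MvPolynomial.coeff_C_mul, MvPolynomial.coeff_map, MvPolynomial.coeff_map] at this
    rw [eq_div_iff hD, hDeval, ← evalGenHom_apply, map_sum, Finset.mul_sum]
    refine Finset.sum_congr rfl fun m _ => ?_
    rw [map_mul, h3]
    ring

end Generate

end Measurement
theorem mainTheorem1 (n : ℕ) :
    -- the invariant frame exists on a Zariski open set that meets every fibre of `J^3(V) → J^0(V)`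
    (∃ R : MvPolynomial (Measurement.FiberIndex n 3) ℝ,
      (∀ (x : Measurement.Space n) (u : ℝ), ∃ z ∈ Measurement.JetSpace n 3,
        z.base = x ∧ z.value = u ∧ MvPolynomial.eval z.fiber R ≠ 0) ∧
      ∀ (f : Measurement.Space n → ℝ) (x : Measurement.Space n), ContDiff ℝ ∞ f →
        (Measurement.IsRegularAt f x ↔
          MvPolynomial.eval (Measurement.jet 3 f x).fiber R ≠ 0)) ∧
    -- every frame coefficient is a scalar differential invariant
    (∀ I : Measurement.GenIndex n,
      ∃ φ : Measurement.RationalJetFunction n 2 (max 3 (I.1 + 2)), φ.IsInvariant ∧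
        ∀ (f : Measurement.Space n → ℝ) (x : Measurement.Space n), ContDiff ℝ ∞ f →
          (Measurement.hess f x).det ≠ 0 →
            φ.IsDefinedAt (Measurement.jet (max 3 (I.1 + 2)) f x) ∧
            φ.val (Measurement.jet (max 3 (I.1 + 2)) f x) = Measurement.generator f x I) ∧
    -- the frame coefficients, together with `u`, generate all scalar differential invariants
    (∀ l k : ℕ, 2 ≤ l → ∀ φ : Measurement.RationalJetFunction n l k, φ.IsInvariant →
      ∃ N D : MvPolynomial (Measurement.GenIndex n) (ℝ → ℝ),
        (∀ m, ContDiff ℝ ∞ (N.coeff m)) ∧ (∀ m, ContDiff ℝ ∞ (D.coeff m)) ∧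
        (∀ I ∈ D.vars, I.1 + 2 ≤ l) ∧
        (∀ (x : Measurement.Space n) (u : ℝ), ∃ f : Measurement.Space n → ℝ,
          ContDiff ℝ ∞ f ∧ f x = u ∧ Measurement.IsRegularAt f x ∧
            Measurement.evalGen D f x ≠ 0) ∧
        ∀ (f : Measurement.Space n → ℝ) (x : Measurement.Space n), ContDiff ℝ ∞ f →
          Measurement.IsRegularAt f x → φ.IsDefinedAt (Measurement.jet k f x) →
            Measurement.evalGen D f x ≠ 0 →
              φ.val (Measurement.jet k f x) =
                Measurement.evalGen N f x / Measurement.evalGen D f x) := by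
  refine ⟨?_, Measurement.exists_rationalJetFunction_generator, fun l k hl φ hφ =>
    Measurement.exists_generators_of_isInvariant hl φ hφ⟩
  obtain ⟨R, hR⟩ := Measurement.exists_regularPoly n
  refine ⟨R, fun x u => ?_, fun f x hf => hR ⟨f, hf⟩ x⟩
  have hf := Measurement.contDiff_regularFun x u
  exact ⟨Measurement.jet 3 (Measurement.regularFun x u) x, ⟨_, x, hf, rfl⟩, rfl,
    Measurement.regularFun_self x u,
    (hR ⟨_, hf⟩ x).1 (Measurement.isRegularAt_regularFun x u)⟩
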